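/- Throughout, C*-algebras need not be unital. For a C*-algebra $A$, the cone over $A$ is the C*-algebra $CA=C_0((0,1])\otimes A=C_0((0,1],A)$. A linear map between C*-algebras is cpc if it is completely positive and contractive. Let $A$ be a separable C*-algebra, let $B$ be a C*-algebra, let $I$ be a closed two-sided ideal of $B$ with quotient map $q\colon B\to B/I$, and let $f\colon CA\to B/I$ be a $*$-homomorphism. Suppose that $f$ has a cpc lift, that is, there is a cpc map $\phi\colon CA\to B$ with $q\circ\phi=f$. Then $f$ lifts to a cpc asymptotic homomorphism, both in the discrete and in the continuous sense: (1) (discrete version) there are cpc maps $\psi_n\colon CA\to B$, $n\in\mathbb N$, with $q\circ\psi_n=f$ for every $n$, such that $(\psi_n)_{n\in\mathbb N}$ is a discrete asymptotic homomorphism; (2) (continuous version) there are cpc maps $\psi_t\colon CA\to B$, $t\in[1,\infty)$, with $q\circ\psi_t=f$ for every $t$, such that $(\psi_t)_{t\in[1,\infty)}$ is an asymptotic homomorphism. Here a family of maps $\psi_\lambda\colon E\to B$ from a C*-algebra $E$ to $B$, indexed by $\lambda\in\mathbb N$ or $\lambda\in[1,\infty)$, is considered under the conditions that for all $x,y\in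 E$ and $\mu_1,\mu_2\in\mathbb C$ $$\lim_{\lambda\to\infty}\|\psi_\lambda(x^*)-\psi_\lambda(x)^*\|=0,\qquad \lim_{\lambda\to\infty}\|\psi_\lambda(\mu_1x+\mu_2y)-\mu_1\psi_\lambda(x)-\mu_2\psi_\lambda(y)\|=0,\qquad \lim_{\lambda\to\infty}\|\psi_\lambda(xy)-\psi_\lambda(x)\psi_\lambda(y)\|=0.$$ For the index set $\mathbb N$ it is a discrete asymptotic homomorphism if these conditions hold and $\sup_{n}\|\psi_n(x)\|<\infty$ for every $x\in E$; for the index set $[1,\infty)$ it is an asymptotic homomorphism if these conditions hold and $t\mapsto\psi_t(x)$ is continuous for every $x\in E$. -/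

import Mathlib

open Filter Topology
open scoped CStarAlgebra ZeroAtInfty

/-! ### Quotients of C⋆-algebras by closed two-sided ideals -/

section Ideal

variable {B : Type*} [NonUnitalCStarAlgebra B]

/-- A norm-closed two-sided ideal of a (non-unital) C⋆-algebra is stable under complex scalars. -/
theorem TwoSidedIdeal.smul_mem_of_isClosed (I : TwoSidedIdeal B) (hI : IsClosed (I : Set B))
    (c : ℂ) {x : B} (hx : x ∈ I) : c • x ∈ I := by
  let _ := CStarAlgebra.spectralOrder B
  have := CStarAlgebra.spectralOrderedRing B
  have h := (CStarAlgebra.increasingApproximateUnit B).tendsto_mul_left (c • x)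
  have := (CStarAlgebra.increasingApproximateUnit B).neBot
  refine hI.mem_of_tendsto h (Eventually.of_forall fun e => ?_)
  rw [smul_mul_assoc, ← mul_smul_comm]
  exact I.mul_mem_right _ _ hx

/-- The closed ⋆-subalgebra of all elements of a closed two-sided ideal whose adjoint is in the
ideal as well. -/
def TwoSidedIdeal.starPart (I : TwoSidedIdeal B) (hI : IsClosed (I : Set B)) :
    NonUnitalStarSubalgebra ℂ B where
  carrier := {x | x ∈ I ∧ star x ∈ I}
  zero_mem' := ⟨I.zero_mem, by simp [I.zero_mem]⟩
  add_mem' hx hy := ⟨I.add_mem hx.1 hy.1, by simpa using I.add_mem hx.2 hy.2⟩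
  mul_mem' hx hy := ⟨I.mul_mem_left _ _ hy.1, by simpa using I.mul_mem_left _ _ hx.2⟩
  smul_mem' c x hx := ⟨I.smul_mem_of_isClosed hI c hx.1, by
    simpa [star_smul] using I.smul_mem_of_isClosed hI (star c) hx.2⟩
  star_mem' hx := ⟨hx.2, by simpa using hx.1⟩

/-- A norm-closed two-sided ideal of a C⋆-algebra is self-adjoint. -/
theorem TwoSidedIdeal.star_mem_of_isClosed (I : TwoSidedIdeal B) (hI : IsClosed (I : Set B))
    {x : B} (hx : x ∈ I) : star x ∈ I := by
  let J := I.starPart hI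
  have hJ : IsClosed (J : Set B) :=
    hI.inter (hI.preimage (continuous_star (R := B)))
  let _ := CStarAlgebra.spectralOrder J
  have := CStarAlgebra.spectralOrderedRing J
  have hu := CStarAlgebra.increasingApproximateUnit J
  have := hu.neBot
  have ha : x * star x ∈ J := ⟨I.mul_mem_right _ _ hx, by simpa using I.mul_mem_right _ _ hx⟩
  let a : J := ⟨x * star x, ha⟩
  have h0 : Tendsto (fun e : J => ‖a - e * a‖) (CStarAlgebra.approximateUnit J) (𝓝 0) := by
    have h1 := (tendsto_const_nhds (x := a)).sub (hu.tendsto_mul_right a)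
    simpa using h1.norm
  have hev := hu.eventually_norm
  have hsa := hu.eventually_star_eq
  have hsq : Tendsto (fun e : J => ‖star x - star x * (e : B)‖ ^ 2)
      (CStarAlgebra.approximateUnit J) (𝓝 0) := by
    have h2 : Tendsto (fun e : J => ‖a - e * a‖ * 2) (CStarAlgebra.approximateUnit J) (𝓝 0) := by
      simpa only [zero_mul] using h0.mul_const 2
    refine squeeze_zero' (Eventually.of_forall fun _ => by positivity) ?_ h2
    filter_upwards [hev, hsa] with e he hs
    have hs' : star (e : B) = e := congrArg Subtype.val hs
    have key : star (star x - star x * (e : B)) * (star x - star x * (e : B))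
        = (((a - e * a) - (a - e * a) * e : J) : B) := by
      simp [a, hs', sub_mul, mul_sub, mul_assoc]
    rw [sq, ← CStarRing.norm_star_mul_self, key]
    change ‖(a - e * a) - (a - e * a) * e‖ ≤ _
    calc _ ≤ ‖a - e * a‖ + ‖a - e * a‖ * ‖e‖ :=
          (norm_sub_le _ _).trans (by gcongr; exact norm_mul_le _ _)
      _ ≤ ‖a - e * a‖ + ‖a - e * a‖ * 1 := by gcongr
      _ = _ := by rw [mul_one, mul_two]
  have hlim : Tendsto (fun e : J => star x * (e : B)) (CStarAlgebra.approximateUnit J)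
      (𝓝 (star x)) := by
    rw [tendsto_iff_norm_sub_tendsto_zero]
    have := hsq.sqrt
    simpa [norm_sub_rev] using this
  exact hI.mem_of_tendsto hlim (Eventually.of_forall fun e => I.mul_mem_left _ _ e.2.1)

/-- The quotient `B / I` of a C⋆-algebra by a norm-closed two-sided ideal, as a complex ⋆-algebra.
(The ⋆-homomorphisms into the quotient C⋆-algebra are by definition the homomorphisms for this
⋆-algebra structure.) -/
def CStarQuotient (I : TwoSidedIdeal B) (_hI : IsClosed (I : Set B)) : Type _ :=
  I.ringCon.Quotient

namespace CStarQuotient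

variable (I : TwoSidedIdeal B) (hI : IsClosed (I : Set B))

instance : NonUnitalRing (CStarQuotient I hI) :=
  inferInstanceAs (NonUnitalRing I.ringCon.Quotient)

/-- The class in `B / I` of an element of `B`. -/
def of (b : B) : CStarQuotient I hI := (b : I.ringCon.Quotient)

variable {I hI}

theorem of_surjective : Function.Surjective (of I hI) := fun x => Quotient.exists_rep x

theorem of_eq_of_iff {x y : B} : of I hI x = of I hI y ↔ x - y ∈ I :=
  (RingCon.eq I.ringCon).trans (I.rel_iff x y)

theorem of_zero : of I hI 0 = 0 := rfl
theorem of_add (x y : B) : of I hI (x + y) = of I hI x + of I hI y := rfl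
theorem of_mul (x y : B) : of I hI (x * y) = of I hI x * of I hI y := rfl

instance : SMul ℂ (CStarQuotient I hI) where
  smul c := Quotient.lift (fun b => of I hI (c • b)) fun x y h => of_eq_of_iff.2 <| by
    rw [← smul_sub]
    exact I.smul_mem_of_isClosed hI c ((I.rel_iff x y).1 h)

theorem of_smul (c : ℂ) (x : B) : of I hI (c • x) = c • of I hI x := rfl

instance : Module ℂ (CStarQuotient I hI) where
  one_smul x := by
    obtain ⟨x, rfl⟩ := of_surjective x
    rw [← of_smul, one_smul]
  mul_smul c d x := by
    obtain ⟨x, rfl⟩ := of_surjective x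
    simp only [← of_smul, mul_smul]
  smul_zero c := by rw [← of_zero, ← of_smul, smul_zero]
  smul_add c x y := by
    obtain ⟨x, rfl⟩ := of_surjective x
    obtain ⟨y, rfl⟩ := of_surjective y
    simp only [← of_smul, ← of_add, smul_add]
  add_smul c d x := by
    obtain ⟨x, rfl⟩ := of_surjective x
    simp only [← of_smul, ← of_add, add_smul]
  zero_smul x := by
    obtain ⟨x, rfl⟩ := of_surjective x
    rw [← of_smul, zero_smul, of_zero]

instance : IsScalarTower ℂ (CStarQuotient I hI) (CStarQuotient I hI) where
  smul_assoc c x y := by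
    obtain ⟨x, rfl⟩ := of_surjective x
    obtain ⟨y, rfl⟩ := of_surjective y
    simp only [smul_eq_mul, ← of_smul, ← of_mul, smul_mul_assoc]

instance : SMulCommClass ℂ (CStarQuotient I hI) (CStarQuotient I hI) where
  smul_comm c x y := by
    obtain ⟨x, rfl⟩ := of_surjective x
    obtain ⟨y, rfl⟩ := of_surjective y
    simp only [smul_eq_mul, ← of_smul, ← of_mul, mul_smul_comm]

instance : Star (CStarQuotient I hI) where
  star := Quotient.lift (fun b => of I hI (star b)) fun x y h => of_eq_of_iff.2 <| by
    rw [← star_sub]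
    exact I.star_mem_of_isClosed hI ((I.rel_iff x y).1 h)

theorem of_star (x : B) : of I hI (star x) = star (of I hI x) := rfl

instance : StarRing (CStarQuotient I hI) where
  star_involutive x := by
    obtain ⟨x, rfl⟩ := of_surjective x
    rw [← of_star, ← of_star, star_star]
  star_mul x y := by
    obtain ⟨x, rfl⟩ := of_surjective x
    obtain ⟨y, rfl⟩ := of_surjective y
    simp only [← of_star, ← of_mul, star_mul]
  star_add x y := by
    obtain ⟨x, rfl⟩ := of_surjective x
    obtain ⟨y, rfl⟩ := of_surjective y
    simp only [← of_star, ← of_add, star_add]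

instance : StarModule ℂ (CStarQuotient I hI) where
  star_smul c x := by
    obtain ⟨x, rfl⟩ := of_surjective x
    simp only [← of_star, ← of_smul, star_smul]

variable (I hI)

/-- The canonical surjective ⋆-homomorphism `q : B → B / I`. -/
def mk : B →⋆ₙₐ[ℂ] CStarQuotient I hI where
  toFun := of I hI
  map_smul' := of_smul
  map_zero' := of_zero
  map_add' := of_add
  map_mul' := of_mul
  map_star' := of_star

end CStarQuotient

end Ideal

/-! ### Cones -/

section Cone

/-- The cone `CA = C₀((0, 1]) ⊗ A = C₀((0, 1], A)` over a C⋆-algebra `A`. -/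
abbrev Cone (A : Type*) [NonUnitalCStarAlgebra A] : Type _ := C₀(Set.Ioc (0 : ℝ) 1, A)

variable {A : Type*} [NonUnitalCStarAlgebra A]

/-- The usual order of the C⋆-algebra `CA`: `x ≤ y` iff `y - x` is a positive element. -/
noncomputable instance : PartialOrder (Cone A) := CStarAlgebra.spectralOrder _

instance : StarOrderedRing (Cone A) := CStarAlgebra.spectralOrderedRing _

end Cone

/-! ### Asymptotic homomorphisms -/

section Asymptotic

variable {Λ E F : Type*} [Preorder Λ] [NonUnitalCStarAlgebra E] [NonUnitalCStarAlgebra F]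

/-- A family `f_λ : E → F` of (arbitrary) maps is asymptotically self-adjoint, linear and
multiplicative, pointwise on `E`, as `λ → ∞`. -/
structure IsAsymptoticallyStarHom (f : Λ → E → F) : Prop where
  star (a : E) : Tendsto (fun l => ‖f l (star a) - star (f l a)‖) atTop (𝓝 0)
  linear (a b : E) (μ₁ μ₂ : ℂ) :
    Tendsto (fun l => ‖f l (μ₁ • a + μ₂ • b) - μ₁ • f l a - μ₂ • f l b‖) atTop (𝓝 0)
  mul (a b : E) : Tendsto (fun l => ‖f l (a * b) - f l a * f l b‖) atTop (𝓝 0)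

/-- An asymptotic homomorphism `(f_t)`, `t ∈ [1, ∞)`: the conditions above together with
continuity of `t ↦ f_t(a)` for every `a`. -/
structure IsAsymptoticHom (f : Set.Ici (1 : ℝ) → E → F) : Prop
    extends IsAsymptoticallyStarHom f where
  continuous (a : E) : Continuous fun t => f t a

/-- A discrete asymptotic homomorphism `(f_λ)`: the conditions above together with
`sup_λ ‖f_λ(a)‖ < ∞` for every `a`. -/
structure IsDiscreteAsymptoticHom (f : Λ → E → F) : Prop extends IsAsymptoticallyStarHom f where
  bounded (a : E) : ∃ C : ℝ, ∀ l, ‖f l a‖ ≤ C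

/-- A map between C⋆-algebras is contractive if `‖φ(x)‖ ≤ ‖x‖` for all `x`. -/
def IsContractive (φ : E → F) : Prop := ∀ x, ‖φ x‖ ≤ ‖x‖

end Asymptotic

/-- `φ : E → B` is a lift of `f : E → B / I`, that is `q ∘ φ = f`. -/
def IsLift {E B : Type*} [NonUnitalCStarAlgebra B] {I : TwoSidedIdeal B}
    {hI : IsClosed (I : Set B)} (φ : E → B) (f : E → CStarQuotient I hI) : Prop :=
  ∀ x, CStarQuotient.mk I hI (φ x) = f x

/-! The multiplicativity defects `φ x * φ y - φ (x * y)` of the given cpc lift lie in `I`, since `f`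
is multiplicative. Compressing `φ` by `1 - e`, with `e` an approximate unit of `I`, would kill them,
but such a cut-off is not multiplicative where it passes from 1 to 0. The cone offers a way out
because it is contractible: the dilations `x ↦ x (ρ ·)` are endomorphisms joining 0 to the identity,
so `φ` can be slid down to 0 along the spectrum of `e`.

Choose quasicentral `e` in `I`, depending continuously on `t`, and let `T k` be the square root of
the tent function at `k`, evaluated at `h = (t + 1) • e`. The `T k` have squares summing to 1. The
lift (`coneLift`) is `ψ_t x = ∑ T k * φ (x (ρ_k ·)) * T k` with `ρ_k = max 0 (1 - k / t)`. It is
completely positive, and contractive as a product of a row, a diagonal and a column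
(`norm_sum_mul_mul_le`). Modulo `I` only the block `k = 0` survives, where `T 0` is 1 and `ρ_0 = 1`;
hence `ψ_t` lifts `f`.

Asymptotic multiplicativity (`norm_sum_conj_mul_sub_le`, `norm_coneLift_mul_sub_le`) has three
sources. The `T k` almost commute with the relevant values of `φ`, by quasicentrality. Only
neighbouring blocks overlap, and their scales differ by at most `1 / t`. The defect `l` inside block
`k` disappears: for `t ≤ k` the scale is 0, and for `k < t` the relation `h * l ≈ (t + 1) • l` gives
`T k * l ≈ 0`, because the `k`-th tent vanishes at `t + 1`. -/

/-! ### Row and column estimates. -/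

section RowColumn

variable {C : Type*} [NonUnitalCStarAlgebra C] [PartialOrder C] [StarOrderedRing C]

-- The Cauchy–Schwarz inequality in the Hilbert C⋆-module of `ι`-tuples over `C`.
open scoped InnerProductSpace in
theorem norm_sum_mul_star_sq_le {ι : Type*} [Fintype ι] (x y : ι → C) :
    ‖∑ i, y i * star (x i)‖ ^ 2 ≤ ‖∑ i, x i * star (x i)‖ * ‖∑ i, y i * star (y i)‖ := by
  let X : WithCStarModule C (ι → C) := (WithCStarModule.equiv C (ι → C)).symm x
  let Y : WithCStarModule C (ι → C) := (WithCStarModule.equiv C (ι → C)).symm y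
  have h : ‖⟪X, Y⟫_C‖ ≤ ‖X‖ * ‖Y‖ := CStarModule.norm_inner_le _
  have h2 : ‖⟪X, Y⟫_C‖ ^ 2 ≤ (‖X‖ * ‖Y‖) ^ 2 := by gcongr
  rwa [mul_pow, WithCStarModule.pi_norm_sq, WithCStarModule.pi_norm_sq,
    WithCStarModule.pi_inner] at h2

/-- A sum `∑ xᵢ zᵢ yᵢ` is a product of a row, a diagonal matrix and a column. -/
theorem norm_sum_mul_mul_le {ι : Type*} (s : Finset ι) (x z y : ι → C) {M : ℝ} (hM : 0 ≤ M)
    (hz : ∀ i ∈ s, ‖z i‖ ≤ M) (hx : ‖∑ i ∈ s, x i * star (x i)‖ ≤ 1)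
    (hy : ‖∑ i ∈ s, star (y i) * y i‖ ≤ 1) : ‖∑ i ∈ s, x i * z i * y i‖ ≤ M := by
  have h := norm_sum_mul_star_sq_le (fun i : s => star (y i)) (fun i : s => x i * z i)
  simp only [star_star] at h
  rw [Finset.sum_coe_sort s fun i => x i * z i * y i,
    Finset.sum_coe_sort s fun i => star (y i) * y i,
    Finset.sum_coe_sort s fun i => x i * z i * star (x i * z i)] at h
  have h1 : ‖∑ i ∈ s, x i * z i * star (x i * z i)‖ ≤ M ^ 2 := by
    have hle : ∑ i ∈ s, x i * z i * star (x i * z i) ≤ ∑ i ∈ s, M ^ 2 • (x i * star (x i)) := by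
      refine Finset.sum_le_sum fun i hi => ?_
      have h2 : x i * z i * star (x i * z i) = x i * (z i * star (z i)) * star (x i) := by
        simp only [star_mul, mul_assoc]
      rw [h2]
      refine (CStarAlgebra.star_right_conjugate_le_norm_smul).trans ?_
      rw [CStarRing.norm_self_mul_star, ← sq]
      exact smul_le_smul_of_nonneg_right (by gcongr; exact hz i hi) (mul_star_self_nonneg _)
    refine (CStarAlgebra.norm_le_norm_of_nonneg_of_le
      (Finset.sum_nonneg fun i _ => mul_star_self_nonneg _) hle).trans ?_
    rw [← Finset.smul_sum, norm_smul, Real.norm_of_nonneg (by positivity)]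
    exact mul_le_of_le_one_right (by positivity) hx
  refine abs_le_of_sq_le_sq' (h.trans ?_) hM |>.2
  calc _ ≤ 1 * M ^ 2 := by gcongr
    _ = _ := one_mul _

end RowColumn

/-! ### Sums of compressions by a quadratic partition of unity. -/

section Blocks

variable {C : Type*} [CStarAlgebra C]

/-- The family of compressions by a quadratic partition of unity is contractive. -/
theorem norm_sum_conj_le [PartialOrder C] [StarOrderedRing C] {N : ℕ} {T : ℕ → C}
    (hsa : ∀ k, star (T k) = T k)
    (hsum : ∑ k ∈ Finset.range N, T k * T k = 1) (z : ℕ → C) {M : ℝ} (hM : 0 ≤ M)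
    (hz : ∀ k < N, ‖z k‖ ≤ M) : ‖∑ k ∈ Finset.range N, T k * z k * T k‖ ≤ M := by
  cases subsingleton_or_nontrivial C
  · rw [Subsingleton.elim (∑ k ∈ Finset.range N, T k * z k * T k) 0, norm_zero]
    exact hM
  refine norm_sum_mul_mul_le _ _ _ _ hM (fun i hi => hz i (Finset.mem_range.1 hi)) ?_ ?_ <;>
  simp [hsa, hsum]

/-- At most three indices contribute, so the bound does not grow with `N`. -/
theorem norm_sum_range_le_of_tridiagonal {E : Type*} [SeminormedAddCommGroup E] {N : ℕ} (k : ℕ)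
    (w : ℕ → E) {c : ℝ} (h0 : ∀ j, j + 1 < k ∨ k + 1 < j → w j = 0)
    (hc : ∀ j < N, j ≤ k + 1 → k ≤ j + 1 → ‖w j‖ ≤ c) (hc0 : 0 ≤ c) :
    ‖∑ j ∈ Finset.range N, w j‖ ≤ 3 * c := by
  have h1 : ∑ j ∈ Finset.range N, w j
      = ∑ j ∈ (Finset.range N).filter (fun j => j ≤ k + 1 ∧ k ≤ j + 1), w j := by
    refine (Finset.sum_filter_of_ne fun j _ hj => ?_).symm
    by_contra h
    exact hj (h0 j (by omega))
  have hcard : ((Finset.range N).filter (fun j => j ≤ k + 1 ∧ k ≤ j + 1)).card ≤ 3 := by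
    refine (Finset.card_le_card (t := Finset.Icc (k - 1) (k + 1)) fun j hj => ?_).trans ?_
    · simp only [Finset.mem_filter, Finset.mem_Icc] at hj ⊢
      omega
    · simp only [Nat.card_Icc]
      omega
  rw [h1]
  refine (norm_sum_le_of_le (f := w) _ (n := fun _ => c) fun j hj => ?_).trans ?_
  · simp only [Finset.mem_filter, Finset.mem_range] at hj
    exact hc j hj.1 hj.2.1 hj.2.2
  · rw [Finset.sum_const, nsmul_eq_mul]
    gcongr
    exact_mod_cast hcard

theorem norm_le_one_of_sum_mul_self_eq_one [PartialOrder C] [StarOrderedRing C] {N : ℕ}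
    {T : ℕ → C} (hsa : ∀ k, star (T k) = T k)
    (hsum : ∑ k ∈ Finset.range N, T k * T k = 1) {k : ℕ} (hk : k < N) : ‖T k‖ ≤ 1 := by
  nontriviality C
  have h0 : ∀ j, 0 ≤ T j * T j := fun j => by simpa [hsa] using star_mul_self_nonneg (T j)
  have h : T k * T k ≤ 1 := hsum ▸
    Finset.single_le_sum (f := fun k => T k * T k) (fun j _ => h0 j) (Finset.mem_range.2 hk)
  have h2 := CStarAlgebra.norm_le_norm_of_nonneg_of_le (h0 k) h
  rw [norm_one] at h2
  have h3 : ‖T k * T k‖ = ‖T k‖ * ‖T k‖ := by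
    simpa [hsa] using CStarRing.norm_star_mul_self (x := T k)
  nlinarith [norm_nonneg (T k)]

/-- Approximate multiplicativity of a sum of compressions by a quadratic partition of unity whose
members almost commute with the entries and overlap only if they are neighbours. -/
theorem norm_sum_conj_mul_sub_le [PartialOrder C] [StarOrderedRing C] {N : ℕ} {T : ℕ → C}
    (hsa : ∀ k, star (T k) = T k) (hcomm : ∀ j k, T j * T k = T k * T j)
    (horth : ∀ j k, j + 1 < k ∨ k + 1 < j → T j * T k = 0)
    (hsum : ∑ k ∈ Finset.range N, T k * T k = 1) (a b c : ℕ → C) {M δ η : ℝ}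
    (hM : 0 ≤ M) (hδ : 0 ≤ δ) (hη : 0 ≤ η)
    (hb : ∀ k < N, ‖b k‖ ≤ M)
    (hTa : ∀ j < N, ∀ k < N, ‖T k * a j - a j * T k‖ ≤ δ)
    (hTc : ∀ k < N, ‖T k * (a k * b k - c k)‖ ≤ δ)
    (haa : ∀ j < N, ∀ k < N, j ≤ k + 1 → k ≤ j + 1 → ‖a j - a k‖ ≤ η) :
    ‖(∑ k ∈ Finset.range N, T k * a k * T k) * (∑ k ∈ Finset.range N, T k * b k * T k)
      - ∑ k ∈ Finset.range N, T k * c k * T k‖ ≤ N * (δ * M) + 3 * ((δ + η) * M) + N * δ := by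
  have hT1 : ∀ k < N, ‖T k‖ ≤ 1 := fun k hk => norm_le_one_of_sum_mul_self_eq_one hsa hsum hk
  set P := ∑ k ∈ Finset.range N, T k * a k * T k with hP
  -- The `T j` commute with each other, so the commutator is again a sum of compressions, with
  -- entries `[a j, T k]`; its norm is at most `δ`, without a factor `N`.
  have hPT : ∀ k < N, ‖P * T k - T k * P‖ ≤ δ := by
    intro k hk
    have : P * T k - T k * P
        = ∑ j ∈ Finset.range N, T j * (a j * T k - T k * a j) * T j := by
      rw [hP, Finset.sum_mul, Finset.mul_sum, ← Finset.sum_sub_distrib]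
      refine Finset.sum_congr rfl fun j _ => ?_
      have h1 : T j * a j * T j * T k = T j * a j * T k * T j := by
        rw [mul_assoc _ (T j), hcomm j k, ← mul_assoc]
      have h2 : T k * (T j * a j * T j) = T j * T k * a j * T j := by
        rw [hcomm j k]
        noncomm_ring
      rw [h1, h2]
      noncomm_ring
    rw [this]
    exact norm_sum_conj_le hsa hsum _ hδ fun j hj => by
      rw [norm_sub_rev]; exact hTa j hj k hk
  -- Next to `T k`, the sum `P` acts like `a k`. The error is kept in the form `T k * D` so that it
  -- can later stand between two copies of `T k`.
  have hTP : ∀ k < N, ∃ D, T k * (P - a k) = T k * D ∧ ‖D‖ ≤ 3 * (δ + η) := by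
    intro k hk
    refine ⟨∑ j ∈ Finset.range N, if j + 1 < k ∨ k + 1 < j then 0 else
        T j * ((a j * T j - T j * a j) + T j * (a j - a k)), ?_, ?_⟩
    · have h1 : a k = ∑ j ∈ Finset.range N, T j * T j * a k := by
        rw [← Finset.sum_mul, hsum, one_mul]
      conv_lhs => rw [h1, hP, ← Finset.sum_sub_distrib]
      rw [Finset.mul_sum, Finset.mul_sum]
      refine Finset.sum_congr rfl fun j _ => ?_
      split_ifs with hj
      · have h2 : T k * T j = 0 := horth k j (by omega)
        calc _ = (T k * T j) * (a j * T j - T j * a k) := by noncomm_ring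
          _ = _ := by rw [h2, zero_mul, mul_zero]
      · noncomm_ring
    refine norm_sum_range_le_of_tridiagonal k _ (fun j hj => if_pos hj) (fun j hj h1 h2 => ?_)
      (by positivity)
    rw [if_neg (by omega)]
    have h4 : ‖a j * T j - T j * a j‖ ≤ δ := by
      rw [norm_sub_rev]; exact hTa j hj j hj
    have h5 : ‖T j * (a j - a k)‖ ≤ 1 * η := (norm_mul_le _ _).trans
      (mul_le_mul (hT1 j hj) (haa j hj k hk h1 h2) (norm_nonneg _) zero_le_one)
    calc _ ≤ 1 * (δ + η) := (norm_mul_le _ _).trans <|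
          mul_le_mul (hT1 j hj) ((norm_add_le _ _).trans (by linarith)) (norm_nonneg _) zero_le_one
      _ = _ := one_mul _
  choose! D hD hDn using hTP
  -- The middle sum carries `η`, which is not small compared with `1 / N`; it is bounded by
  -- `norm_sum_conj_le`. The outer sums involve only `δ` and tolerate the triangle inequality.
  have key : P * (∑ k ∈ Finset.range N, T k * b k * T k) - ∑ k ∈ Finset.range N, T k * c k * T k
      = ∑ k ∈ Finset.range N, (P * T k - T k * P) * b k * T k
        + ∑ k ∈ Finset.range N, T k * (D k * b k) * T k
        + ∑ k ∈ Finset.range N, T k * (a k * b k - c k) * T k := by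
    rw [Finset.mul_sum, ← Finset.sum_sub_distrib, ← Finset.sum_add_distrib,
      ← Finset.sum_add_distrib]
    refine Finset.sum_congr rfl fun k hk => ?_
    rw [← mul_assoc (T k) (D k), ← hD k (Finset.mem_range.1 hk)]
    noncomm_ring
  rw [key]
  refine (norm_add₃_le).trans (add_le_add (add_le_add ?_ ?_) ?_)
  · refine (norm_sum_le_of_le _ (n := fun _ => δ * M) fun k hk => ?_).trans (by simp)
    have hk := Finset.mem_range.1 hk
    calc _ ≤ ‖P * T k - T k * P‖ * ‖b k‖ * ‖T k‖ := norm_mul₃_le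
      _ ≤ δ * M * 1 := by
        gcongr
        exacts [hPT k hk, hb k hk, hT1 k hk]
      _ = _ := mul_one _
  · refine norm_sum_conj_le hsa hsum _ (by positivity) fun k hk => ?_
    refine (norm_mul_le _ _).trans ?_
    rw [← mul_assoc]
    gcongr
    exacts [hDn k hk, hb k hk]
  · refine (norm_sum_le_of_le _ (n := fun _ => δ) fun k hk => ?_).trans (by simp)
    have hk := Finset.mem_range.1 hk
    calc _ ≤ ‖T k * (a k * b k - c k)‖ * ‖T k‖ := norm_mul_le _ _
      _ ≤ δ * 1 := by
        gcongr
        exacts [hTc k hk, hT1 k hk]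
      _ = _ := mul_one _

end Blocks

/-! ### Functional calculus and approximate intertwining. -/

section FunctionalCalculus

variable {C : Type*} [CStarAlgebra C]

-- For monomials this is induction along the Leibniz rule. `K` depends on `p` and `R` but not on the
-- elements. Two elements `h`, `h'` are allowed because `h'` will be either `h` or a scalar.
open Polynomial in
theorem exists_norm_aeval_mul_sub_mul_aeval_le (C : Type*) [CStarAlgebra C] {R : ℝ} (hR : 0 ≤ R)
    (p : ℝ[X]) : ∃ K, 0 ≤ K ∧ ∀ h h' b : C, ‖h‖ ≤ R → ‖h'‖ ≤ R →
      ‖aeval h p * b - b * aeval h' p‖ ≤ K * ‖h * b - b * h'‖ := by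
  induction p using Polynomial.induction_on' with
  | add p q hp hq =>
    obtain ⟨K, hK, hp⟩ := hp
    obtain ⟨L, hL, hq⟩ := hq
    refine ⟨K + L, by positivity, fun h h' b hh hh' => ?_⟩
    rw [add_mul, map_add, map_add, add_mul, mul_add, add_sub_add_comm]
    exact (norm_add_le _ _).trans (add_le_add (hp h h' b hh hh') (hq h h' b hh hh'))
  | monomial n c =>
    suffices H : ∃ K, 0 ≤ K ∧ ∀ h h' b : C, ‖h‖ ≤ R → ‖h'‖ ≤ R →
        ‖h ^ n * b - b * h' ^ n‖ ≤ K * ‖h * b - b * h'‖ by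
      obtain ⟨K, hK, H⟩ := H
      refine ⟨‖c‖ * K, by positivity, fun h h' b hh hh' => ?_⟩
      simp only [aeval_monomial, ← Algebra.smul_def, smul_mul_assoc, mul_smul_comm]
      rw [← smul_sub, norm_smul, mul_assoc]
      gcongr
      exact H h h' b hh hh'
    induction n with
    | zero => exact ⟨0, le_rfl, fun h h' b _ _ => by simp⟩
    | succ n ih =>
      obtain ⟨K, hK, H⟩ := ih
      cases subsingleton_or_nontrivial C
      · exact ⟨0, le_rfl, fun h h' b _ _ => by
          rw [Subsingleton.elim (h ^ (n + 1) * b - b * h' ^ (n + 1)) 0, norm_zero, zero_mul]⟩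
      refine ⟨R ^ n + K * R, by positivity, fun h h' b hh hh' => ?_⟩
      have e : h ^ (n + 1) * b - b * h' ^ (n + 1)
          = h ^ n * (h * b - b * h') + (h ^ n * b - b * h' ^ n) * h' := by
        simp only [pow_succ]
        noncomm_ring
      rw [e, add_mul]
      refine (norm_add_le _ _).trans (add_le_add ?_ ?_)
      · refine (norm_mul_le _ _).trans ?_
        gcongr
        exact (norm_pow_le _ _).trans (by gcongr)
      · refine (norm_mul_le _ _).trans ?_
        rw [mul_right_comm]
        gcongr
        exact H h h' b hh hh'

/-- Functional calculus preserves approximate intertwining, uniformly over all self-adjoint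
elements with spectrum in a fixed compact interval. -/
theorem exists_norm_cfc_mul_sub_mul_cfc_le (C : Type*) [CStarAlgebra C] {R : ℝ} (hR : 0 ≤ R)
    {f : ℝ → ℝ} (hf : ContinuousOn f (Set.Icc 0 R)) {ε : ℝ} (hε : 0 < ε) :
    ∃ K, 0 ≤ K ∧ ∀ h h' b : C, IsSelfAdjoint h → IsSelfAdjoint h' →
      spectrum ℝ h ⊆ Set.Icc 0 R → spectrum ℝ h' ⊆ Set.Icc 0 R →
      ‖cfc f h * b - b * cfc f h'‖ ≤ ε * ‖b‖ + K * ‖h * b - b * h'‖ := by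
  obtain ⟨p, hp⟩ := exists_polynomial_near_of_continuousOn 0 R f hf (ε / 2) (half_pos hε)
  obtain ⟨K, hK, H⟩ := exists_norm_aeval_mul_sub_mul_aeval_le C hR p
  have hnorm : ∀ h : C, IsSelfAdjoint h → spectrum ℝ h ⊆ Set.Icc 0 R → ‖h‖ ≤ R := by
    intro h hh hs
    conv_lhs => rw [← cfc_id ℝ h]
    refine norm_cfc_le hR fun x hx => ?_
    rw [id, Real.norm_of_nonneg (hs hx).1]
    exact (hs hx).2
  have hap : ∀ h : C, IsSelfAdjoint h → spectrum ℝ h ⊆ Set.Icc 0 R →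
      ‖cfc f h - Polynomial.aeval h p‖ ≤ ε / 2 := by
    intro h hh hs
    rw [← cfc_polynomial p h, ← cfc_sub f p.eval h (hf.mono hs)
      p.continuous.continuousOn]
    refine norm_cfc_le (half_pos hε).le fun x hx => ?_
    rw [norm_sub_rev]
    exact (hp x (hs hx)).le
  refine ⟨K, hK, fun h h' b hh hh' hs hs' => ?_⟩
  have e : cfc f h * b - b * cfc f h' = (cfc f h - Polynomial.aeval h p) * b
      - b * (cfc f h' - Polynomial.aeval h' p)
      + (Polynomial.aeval h p * b - b * Polynomial.aeval h' p) := by noncomm_ring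
  rw [e]
  refine (norm_add_le _ _).trans (add_le_add ((norm_sub_le _ _).trans ?_)
    (H h h' b (hnorm h hh hs) (hnorm h' hh' hs')))
  calc _ ≤ ε / 2 * ‖b‖ + ‖b‖ * (ε / 2) := by
        refine add_le_add ((norm_mul_le _ _).trans ?_) ((norm_mul_le _ _).trans ?_)
        · gcongr; exact hap h hh hs
        · gcongr; exact hap h' hh' hs'
    _ = _ := by ring

end FunctionalCalculus

/-! ### Quasicentral elements of closed ideals. -/

section QuasiCentral

/-- Recursive choice from the increasing approximate unit. The finite set `W` may depend on the
current element, so that `u k` and the products `u k * b` can be included. Increments are recorded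
as `star s * s`, a form that survives the inclusion of `J` in a larger algebra. -/
theorem CStarAlgebra.exists_monotone_approximateUnit {J : Type*} [NonUnitalCStarAlgebra J]
    [PartialOrder J] [StarOrderedRing J] (W : J → Set J) (hW : ∀ u, (W u).Finite) {ε : ℝ}
    (hε : 0 < ε) : ∃ u : ℕ → J, u 0 = 0 ∧ (∀ k, ∃ s, u (k + 1) - u k = star s * s) ∧
      (∀ k, ‖u k‖ ≤ 1) ∧ ∀ k, ∀ w ∈ W (u k), ‖u (k + 1) * w - w‖ ≤ ε ∧ ‖w * u (k + 1) - w‖ ≤ ε := by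
  have step : ∀ u : {u : J // 0 ≤ u ∧ ‖u‖ < 1}, ∃ v : {u : J // 0 ≤ u ∧ ‖u‖ < 1},
      (u : J) ≤ v ∧ ∀ w ∈ W u, ‖(v : J) * w - w‖ ≤ ε ∧ ‖w * (v : J) - w‖ ≤ ε := by
    intro u
    have hu := CStarAlgebra.increasingApproximateUnit J
    have h1 : ∀ᶠ v in CStarAlgebra.approximateUnit J, ∀ w ∈ W u,
        ‖v * w - w‖ ≤ ε ∧ ‖w * v - w‖ ≤ ε := by
      refine (Set.Finite.eventually_all (hW u)).2 fun w _ => ?_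
      have e1 := (hu.tendsto_mul_right w).eventually (Metric.closedBall_mem_nhds w hε)
      have e2 := (hu.tendsto_mul_left w).eventually (Metric.closedBall_mem_nhds w hε)
      filter_upwards [e1, e2] with v h1 h2
      exact ⟨by simpa [dist_eq_norm] using h1, by simpa [dist_eq_norm] using h2⟩
    have h2 : ∀ᶠ v in CStarAlgebra.approximateUnit J, (u : J) ≤ v := by
      filter_upwards [(CStarAlgebra.hasBasis_approximateUnit J).mem_of_mem u.2] with v hv
      exact hv.1
    obtain ⟨x, hx, hxs⟩ := (CStarAlgebra.hasBasis_approximateUnit J).eventually_iff.1 (h2.and h1)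
    exact ⟨⟨x, hx⟩, hxs ⟨le_refl x, by simpa using hx.2.le⟩⟩
  choose g hg1 hg2 using step
  let u : ℕ → {u : J // 0 ≤ u ∧ ‖u‖ < 1} := fun k => Nat.rec ⟨0, by simp⟩ (fun _ v => g v) k
  exact ⟨fun k => (u k).1, rfl, fun k =>
    CStarAlgebra.nonneg_iff_eq_star_mul_self.1 (sub_nonneg.2 (hg1 (u k))), fun k => (u k).2.2.le, fun k => hg2 (u k)⟩

variable {B : Type*} [NonUnitalCStarAlgebra B] [PartialOrder B] [StarOrderedRing B]

/-- With `s k` the square root of the `k`-th increment, the summand is `s k * (s k * b * s (k + 1))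
* s (k + 1)`. The squares of row and column telescope to differences of norm at most 1, so the bound
is independent of `n`. -/
theorem norm_sum_increments_conj_le {u : ℕ → B} (h0 : u 0 = 0) (hmono : ∀ k, u k ≤ u (k + 1))
    (hu : ∀ k, ‖u k‖ ≤ 1) (b : B) (n : ℕ) :
    ‖∑ k ∈ Finset.range n, (u (k + 1) - u k) * b * (u (k + 2) - u (k + 1))‖ ≤ ‖b‖ := by
  have hmono' : Monotone u := monotone_nat_of_le_succ hmono
  set v : ℕ → B := fun k => u (k + 1) - u k with hv
  have hv0 : ∀ k, 0 ≤ v k := fun k => sub_nonneg.2 (hmono k)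
  have hvle : ∀ j k, j ≤ k → ‖u k - u j‖ ≤ 1 := fun j k hjk =>
    (CStarAlgebra.norm_le_norm_of_nonneg_of_le (sub_nonneg.2 (hmono' hjk))
      (sub_le_self _ (h0 ▸ hmono' (Nat.zero_le j)))).trans (hu k)
  have hs : ∀ k, star (CFC.sqrt (v k)) = CFC.sqrt (v k) := fun k =>
    (IsSelfAdjoint.of_nonneg (CFC.sqrt_nonneg (v k))).star_eq
  have hss : ∀ k, CFC.sqrt (v k) * CFC.sqrt (v k) = v k := fun k =>
    CFC.sqrt_mul_sqrt_self (v k) (hv0 k)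
  have hs1 : ∀ k, ‖CFC.sqrt (v k)‖ ≤ 1 := by
    intro k
    have h3 : ‖CFC.sqrt (v k) * CFC.sqrt (v k)‖ = ‖CFC.sqrt (v k)‖ * ‖CFC.sqrt (v k)‖ := by
      simpa [hs] using CStarRing.norm_star_mul_self (x := CFC.sqrt (v k))
    rw [hss] at h3
    nlinarith [norm_nonneg (CFC.sqrt (v k)), hvle k (k + 1) (Nat.le_succ k)]
  have e : ∑ k ∈ Finset.range n, (u (k + 1) - u k) * b * (u (k + 2) - u (k + 1))
      = ∑ k ∈ Finset.range n, CFC.sqrt (v k) * (CFC.sqrt (v k) * b * CFC.sqrt (v (k + 1)))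
        * CFC.sqrt (v (k + 1)) := by
    refine Finset.sum_congr rfl fun k _ => ?_
    change v k * b * v (k + 1) = _
    conv_lhs => rw [← hss k, ← hss (k + 1)]
    simp only [mul_assoc]
  rw [e]
  refine norm_sum_mul_mul_le _ _ _ _ (norm_nonneg b) (fun k _ => ?_) ?_ ?_
  · calc _ ≤ ‖CFC.sqrt (v k)‖ * ‖b‖ * ‖CFC.sqrt (v (k + 1))‖ := norm_mul₃_le
      _ ≤ 1 * ‖b‖ * 1 := by gcongr <;> exact hs1 _
      _ = _ := by ring
  · simp only [hs, hss]
    rw [Finset.sum_range_sub]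
    exact hvle 0 n (Nat.zero_le n)
  · simp only [hs, hss]
    rw [Finset.sum_range_sub (fun k => u (k + 1))]
    exact hvle _ _ (by omega)

/-- Since `u k * b * u (k + 1) ≈ u k * b` and `u k * u (k + 1) ≈ u k`, each summand is close to a
product of `b` with consecutive increments. Up to these errors the sum stays bounded in `n`. -/
theorem norm_sum_sub_conj_le {u : ℕ → B} (h0 : u 0 = 0) (hmono : ∀ k, u k ≤ u (k + 1))
    (hu : ∀ k, ‖u k‖ ≤ 1) (b : B) {ε : ℝ} (hε : 0 ≤ ε)
    (hb : ∀ k, ‖u k * b * u (k + 1) - u k * b‖ ≤ ε)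
    (huu : ∀ k, ‖u k * u (k + 1) - u k‖ ≤ ε) (n : ℕ) :
    ‖∑ k ∈ Finset.range n, (u (k + 1) * b - u (k + 1) * b * u (k + 1))‖
      ≤ ‖b‖ + n * (ε * (2 + ‖b‖)) := by
  have key : ∑ k ∈ Finset.range n, (u (k + 1) * b - u (k + 1) * b * u (k + 1))
      = ∑ k ∈ Finset.range n, (u (k + 1) - u k) * b * (u (k + 2) - u (k + 1))
        + ∑ k ∈ Finset.range n, (-(u (k + 1) * b * u (k + 2) - u (k + 1) * b)
          + (-((u k * b * u (k + 1) - u k * b) * u (k + 2))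
            + u k * b * (u (k + 1) * u (k + 2) - u (k + 1)))) := by
    rw [← Finset.sum_add_distrib]
    refine Finset.sum_congr rfl fun k _ => ?_
    noncomm_ring
  rw [key]
  refine (norm_add_le _ _).trans (add_le_add (norm_sum_increments_conj_le h0 hmono hu b n) ?_)
  refine (norm_sum_le_of_le _ (n := fun _ => ε * (2 + ‖b‖)) fun k _ => ?_).trans (by simp)
  calc _ ≤ ε + (ε * 1 + 1 * ‖b‖ * ε) := by
        refine (norm_add_le _ _).trans (add_le_add ?_ ((norm_add_le _ _).trans (add_le_add ?_ ?_)))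
        · rw [norm_neg]
          exact hb (k + 1)
        · rw [norm_neg]
          refine (norm_mul_le _ _).trans ?_
          gcongr
          exacts [hb k, hu _]
        · refine norm_mul₃_le.trans ?_
          gcongr
          exacts [hu _, huu (k + 1)]
    _ = _ := by ring

end QuasiCentral

section QuasiCentralIdeal

variable {B : Type*} [NonUnitalCStarAlgebra B] [PartialOrder B] [StarOrderedRing B]

theorem TwoSidedIdeal.exists_monotone_approximateUnit (I : TwoSidedIdeal B)
    (hI : IsClosed (I : Set B)) {F L : Set B} (hF : F.Finite) (hL : L.Finite) (hLI : L ⊆ I)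
    {ε : ℝ} (hε : 0 < ε) :
    ∃ u : ℕ → B, (∀ k, u k ∈ I) ∧ u 0 = 0 ∧ (∀ k, u k ≤ u (k + 1)) ∧ (∀ k, ‖u k‖ ≤ 1) ∧
      (∀ k, ‖u k * u (k + 1) - u k‖ ≤ ε) ∧
      (∀ k, ∀ b ∈ F, ‖u k * b * u (k + 1) - u k * b‖ ≤ ε) ∧
      ∀ k, ∀ l ∈ L, ‖u (k + 1) * l - l‖ ≤ ε := by
  let J := I.starPart hI
  have hJ : IsClosed (J : Set B) := hI.inter (hI.preimage continuous_star)
  let _ := CStarAlgebra.spectralOrder J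
  have := CStarAlgebra.spectralOrderedRing J
  have hmem : ∀ {x : B}, x ∈ I → x ∈ J := fun hx => ⟨hx, I.star_mem_of_isClosed hI hx⟩
  obtain ⟨u, hu0, hmono, hnorm, hW⟩ := CStarAlgebra.exists_monotone_approximateUnit
    (fun u : J => (Subtype.val : J → B) ⁻¹' (({(u : B)} ∪ (fun b => (u : B) * b) '' F) ∪ L))
    (fun u => (((Set.finite_singleton _).union (hF.image _)).union hL).preimage
      Subtype.val_injective.injOn) hε
  have hW2 : ∀ k, ∀ w (_ : w ∈ I), w ∈ (({(u k : B)} ∪ (fun b => (u k : B) * b) '' F) ∪ L) →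
      ‖(u (k + 1) : B) * w - w‖ ≤ ε ∧ ‖w * (u (k + 1) : B) - w‖ ≤ ε := fun k w hw hw' =>
    hW k ⟨w, hmem hw⟩ hw'
  refine ⟨fun k => u k, fun k => (u k).2.1, by simp [hu0], fun k => ?_, hnorm, fun k => ?_,
    fun k b hb => ?_, fun k l hl => ?_⟩
  · obtain ⟨s, hs⟩ := hmono k
    have h2 : (u (k + 1) : B) - u k = star (s : B) * s := congrArg Subtype.val hs
    rw [← sub_nonneg, h2]
    exact star_mul_self_nonneg _
  · exact (hW2 k _ (u k).2.1 (by simp)).2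
  · exact (hW2 k ((u k : B) * b) (I.mul_mem_right _ _ (u k).2.1)
      (Or.inl (Or.inr ⟨b, hb, rfl⟩))).2
  · exact (hW2 k l (hLI hl) (Or.inr hl)).1

/-- Averaging `n` members of a rapidly absorbing approximate unit divides a commutator sum of
bounded size, up to small errors, by `n`. -/
theorem TwoSidedIdeal.exists_quasicentral_of_finite (I : TwoSidedIdeal B)
    (hI : IsClosed (I : Set B)) {F L : Set B} (hF : F.Finite) (hL : L.Finite) (hLI : L ⊆ I)
    {ε : ℝ} (hε : 0 < ε) :
    ∃ e ∈ I, 0 ≤ e ∧ ‖e‖ ≤ 1 ∧ (∀ b ∈ F, ‖e * b - b * e‖ ≤ ε) ∧ ∀ l ∈ L, ‖e * l - l‖ ≤ ε := by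
  obtain ⟨M, hM0, hM⟩ : ∃ M, 0 ≤ M ∧ ∀ b ∈ F, ‖b‖ ≤ M := by
    obtain ⟨M, hM⟩ := (hF.image norm).bddAbove
    exact ⟨max M 0, le_max_right _ _, fun b hb => (hM ⟨b, hb, rfl⟩).trans (le_max_left _ _)⟩
  -- The commutator sum will be at most `2 * M + 2 * n * (ε / 4)`, which is below `n * ε` for this
  -- `n`.
  obtain ⟨n, hn⟩ := exists_nat_gt (4 * M / ε)
  have hn0 : (0 : ℝ) < n := lt_of_le_of_lt (by positivity) hn
  have hδ : 0 < ε / (4 * (2 + M)) := by positivity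
  have hδε : ε / (4 * (2 + M)) ≤ ε := div_le_self hε.le (by linarith)
  obtain ⟨u, huI, hu0, hmono, hnorm, huu, huF, huL⟩ :=
    I.exists_monotone_approximateUnit hI (hF.union (hF.image star)) hL hLI hδ
  have hmono' : Monotone u := monotone_nat_of_le_succ hmono
  have hupos : ∀ k, 0 ≤ u k := fun k => hu0 ▸ hmono' (Nat.zero_le k)
  have hsa : ∀ k, star (u k) = u k := fun k => (IsSelfAdjoint.of_nonneg (hupos k)).star_eq
  have havg : ∀ w : ℕ → B, ∀ c, ‖∑ k ∈ Finset.range n, w k‖ ≤ n * c →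
      ‖(n : ℝ)⁻¹ • ∑ k ∈ Finset.range n, w k‖ ≤ c := by
    intro w c h
    rw [norm_smul, norm_inv, Real.norm_of_nonneg hn0.le, inv_mul_le_iff₀ hn0]
    exact h
  refine ⟨(n : ℝ)⁻¹ • ∑ k ∈ Finset.range n, u (k + 1), ?_, ?_, ?_, fun b hb => ?_,
    fun l hl => ?_⟩
  · have h := I.smul_mem_of_isClosed hI (((n : ℝ)⁻¹ : ℝ) : ℂ)
      (I.finsetSum_mem (Finset.range n) (fun k => u (k + 1)) fun k _ => huI _)
    rwa [Complex.coe_smul] at h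
  · exact smul_nonneg (by positivity) (Finset.sum_nonneg fun k _ => hupos _)
  · refine havg _ _ ((norm_sum_le_of_le _ fun k _ => hnorm _).trans (by simp))
  · have e : ((n : ℝ)⁻¹ • ∑ k ∈ Finset.range n, u (k + 1)) * b
        - b * ((n : ℝ)⁻¹ • ∑ k ∈ Finset.range n, u (k + 1))
        = (n : ℝ)⁻¹ • ∑ k ∈ Finset.range n, (u (k + 1) * b - b * u (k + 1)) := by
      rw [smul_mul_assoc, mul_smul_comm, ← smul_sub, Finset.sum_mul, Finset.mul_sum,
        Finset.sum_sub_distrib]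
    rw [e]
    refine havg _ _ ?_
    -- A commutator splits as `(u b - u b u) - (b u - u b u)`, and the second bracket is the adjoint
    -- of the first one formed with `star b`.
    have e2 : ∑ k ∈ Finset.range n, (u (k + 1) * b - b * u (k + 1))
        = ∑ k ∈ Finset.range n, (u (k + 1) * b - u (k + 1) * b * u (k + 1))
          - star (∑ k ∈ Finset.range n,
            (u (k + 1) * star b - u (k + 1) * star b * u (k + 1))) := by
      rw [star_sum, ← Finset.sum_sub_distrib]
      refine Finset.sum_congr rfl fun k _ => ?_
      simp only [star_sub, star_mul, star_star, hsa, mul_assoc]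
      abel
    have h1 := norm_sum_sub_conj_le hu0 hmono hnorm b hδ.le
      (fun k => huF k b (Or.inl hb)) huu n
    have h2 := norm_sum_sub_conj_le hu0 hmono hnorm (star b) hδ.le
      (fun k => huF k (star b) (Or.inr ⟨b, hb, rfl⟩)) huu n
    rw [norm_star] at h2
    rw [e2]
    refine (norm_sub_le _ _).trans ?_
    rw [norm_star]
    have hbM := hM b hb
    have h3 : ε / (4 * (2 + M)) * (2 + ‖b‖) ≤ ε / 4 := by
      calc _ ≤ ε / (4 * (2 + M)) * (2 + M) := by gcongr
        _ = _ := by field_simp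
    have h4 : 4 * M < n * ε := by rwa [div_lt_iff₀ hε] at hn
    have h5 : n * (ε / (4 * (2 + M)) * (2 + ‖b‖)) ≤ n * (ε / 4) := by gcongr
    linarith
  · have e : ((n : ℝ)⁻¹ • ∑ k ∈ Finset.range n, u (k + 1)) * l - l
        = (n : ℝ)⁻¹ • ∑ k ∈ Finset.range n, (u (k + 1) * l - l) := by
      rw [Finset.sum_sub_distrib, Finset.sum_const, Finset.card_range, smul_sub, ← Finset.sum_mul,
        smul_mul_assoc, ← Nat.cast_smul_eq_nsmul ℝ, smul_smul, inv_mul_cancel₀ hn0.ne', one_smul]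
    rw [e]
    refine havg _ _ ((norm_sum_le_of_le _ fun k _ => (huL k l hl).trans hδε).trans (by simp))

/-- A closed ideal contains elements which are approximately central and approximately unital
with respect to given compact sets. -/
theorem TwoSidedIdeal.exists_quasicentral (I : TwoSidedIdeal B)
    (hI : IsClosed (I : Set B)) {F L : Set B} (hF : IsCompact F) (hL : IsCompact L) (hLI : L ⊆ I)
    {ε : ℝ} (hε : 0 < ε) :
    ∃ e ∈ I, 0 ≤ e ∧ ‖e‖ ≤ 1 ∧ (∀ b ∈ F, ‖e * b - b * e‖ ≤ ε) ∧ ∀ l ∈ L, ‖e * l - l‖ ≤ ε := by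
  obtain ⟨F', hF'F, hF', hFc⟩ := hF.finite_cover_balls (e := ε / 4) (by positivity)
  obtain ⟨L', hL'L, hL', hLc⟩ := hL.finite_cover_balls (e := ε / 4) (by positivity)
  obtain ⟨e, heI, he0, he1, heF, heL⟩ :=
    I.exists_quasicentral_of_finite hI hF' hL' (hL'L.trans hLI) (half_pos hε)
  refine ⟨e, heI, he0, he1, fun b hb => ?_, fun l hl => ?_⟩
  · obtain ⟨c, hc, hbc⟩ := Set.mem_iUnion₂.1 (hFc hb)
    rw [Metric.mem_ball, dist_eq_norm] at hbc
    have h : e * b - b * e = e * (b - c) - (b - c) * e + (e * c - c * e) := by noncomm_ring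
    have h1 : ‖e * (b - c)‖ ≤ 1 * (ε / 4) := (norm_mul_le _ _).trans (by gcongr)
    have h2 : ‖(b - c) * e‖ ≤ ε / 4 * 1 := (norm_mul_le _ _).trans (by gcongr)
    rw [h]
    have h3 := norm_add_le (e * (b - c) - (b - c) * e) (e * c - c * e)
    have h4 := norm_sub_le (e * (b - c)) ((b - c) * e)
    linarith [heF c hc]
  · obtain ⟨c, hc, hbc⟩ := Set.mem_iUnion₂.1 (hLc hl)
    rw [Metric.mem_ball, dist_eq_norm] at hbc
    have h : e * l - l = e * (l - c) - (l - c) + (e * c - c) := by noncomm_ring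
    have h1 : ‖e * (l - c)‖ ≤ 1 * (ε / 4) := (norm_mul_le _ _).trans (by gcongr)
    rw [h]
    have h3 := norm_add_le (e * (l - c) - (l - c)) (e * c - c)
    have h4 := norm_sub_le (e * (l - c)) (l - c)
    linarith [heL c hc]

end QuasiCentralIdeal

/-! ### The cone and its dilations. -/

namespace Cone

variable {A : Type*} [NonUnitalCStarAlgebra A]

theorem norm_apply_le (x : Cone A) (t : Set.Ioc (0 : ℝ) 1) : ‖x t‖ ≤ ‖x‖ :=
  x.toBCF.norm_coe_le_norm t

theorem norm_le {x : Cone A} {c : ℝ} (hc : 0 ≤ c) (h : ∀ t, ‖x t‖ ≤ c) : ‖x‖ ≤ c :=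
  (BoundedContinuousFunction.norm_le (f := x.toBCF) hc).2 h

theorem tendsto_val_cocompact :
    Tendsto (Subtype.val : Set.Ioc (0 : ℝ) 1 → ℝ) (cocompact _) (𝓝 0) := by
  rw [Metric.tendsto_nhds]
  intro c hc
  refine mem_cocompact.2 ⟨Subtype.val ⁻¹' Set.Icc c 1, ?_, fun t ht => ?_⟩
  · have hsub : Set.Icc c 1 ⊆ Set.Ioc (0 : ℝ) 1 := fun t ht => ⟨hc.trans_le ht.1, ht.2⟩
    rw [Subtype.isCompact_iff, Subtype.image_preimage_coe, Set.inter_eq_right.2 hsub]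
    exact isCompact_Icc
  · simp only [Set.mem_compl_iff, Set.mem_preimage, Set.mem_Icc, not_and_or, not_le] at ht
    rcases ht with ht | ht
    · simpa [Real.dist_eq, abs_of_pos t.2.1] using ht
    · exact absurd t.2.2 (not_le.2 ht)

theorem exists_norm_apply_lt (x : Cone A) {ε : ℝ} (hε : 0 < ε) :
    ∃ c > 0, ∀ t : Set.Ioc (0 : ℝ) 1, (t : ℝ) < c → ‖x t‖ < ε := by
  have h := (Metric.tendsto_nhds.1 x.zero_at_infty') ε hε
  obtain ⟨K, hK, hKs⟩ := mem_cocompact.1 h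
  have h0 : (0 : ℝ) ∉ Subtype.val '' K := by
    rintro ⟨t, -, ht⟩
    exact t.2.1.ne' ht
  obtain ⟨c, hc, hcs⟩ := Metric.isOpen_iff.1
    (hK.image continuous_subtype_val).isClosed.isOpen_compl 0 h0
  refine ⟨c, hc, fun t ht => ?_⟩
  have h1 : t ∉ K := fun htK => hcs
    (by rw [Metric.mem_ball, Real.dist_eq, sub_zero, abs_of_pos t.2.1]; exact ht) ⟨t, htK, rfl⟩
  simpa using hKs h1

open Classical in
/-- The extension of an element of the cone to the real line, by `0` on the left and by its value
at `1` on the right. -/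
noncomputable def extend (x : Cone A) (t : ℝ) : A :=
  if h : 0 < t then x ⟨min t 1, lt_min h one_pos, min_le_right _ _⟩ else 0

theorem extend_of_pos (x : Cone A) {t : ℝ} (h : 0 < t) :
    x.extend t = x ⟨min t 1, lt_min h one_pos, min_le_right _ _⟩ := dif_pos h

theorem extend_of_nonpos (x : Cone A) {t : ℝ} (h : t ≤ 0) : x.extend t = 0 := dif_neg (not_lt.2 h)

theorem extend_coe (x : Cone A) (t : Set.Ioc (0 : ℝ) 1) : x.extend t = x t := by
  rw [extend_of_pos x t.2.1]
  congr 1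
  exact Subtype.ext (min_eq_left t.2.2)

theorem norm_extend_le (x : Cone A) (t : ℝ) : ‖x.extend t‖ ≤ ‖x‖ := by
  rcases le_or_gt t 0 with h | h
  · rw [extend_of_nonpos x h, norm_zero]
    exact norm_nonneg x
  · rw [extend_of_pos x h]
    exact norm_apply_le x _

theorem continuous_extend (x : Cone A) : Continuous x.extend := by
  refine continuous_iff_continuousAt.2 fun t => ?_
  rcases le_or_gt t 0 with h | h
  · rw [ContinuousAt, extend_of_nonpos x h, Metric.tendsto_nhds]
    intro ε hε
    obtain ⟨c, hc, hx⟩ := exists_norm_apply_lt x hε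
    filter_upwards [eventually_lt_nhds (show t < c by linarith)] with s hs
    rw [dist_zero_right]
    rcases le_or_gt s 0 with h' | h'
    · rwa [extend_of_nonpos x h', norm_zero]
    · rw [extend_of_pos x h']
      exact hx _ ((min_le_left _ _).trans_lt hs)
  · have hc : ContinuousOn x.extend (Set.Ioi 0) := by
      rw [continuousOn_iff_continuous_domRestrict]
      have : (Set.Ioi (0 : ℝ)).domRestrict x.extend
          = fun s : Set.Ioi (0 : ℝ) => x ⟨min s 1, lt_min s.2 one_pos, min_le_right _ _⟩ := by
        funext s
        exact extend_of_pos x s.2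
      rw [this]
      exact (map_continuous x).comp (by fun_prop)
    exact hc.continuousAt (Ioi_mem_nhds h)

theorem extend_smul (c : ℂ) (x : Cone A) (t : ℝ) : (c • x).extend t = c • x.extend t := by
  simp only [extend]
  split_ifs <;> simp

theorem extend_zero (t : ℝ) : (0 : Cone A).extend t = 0 := by
  simp only [extend]
  split_ifs <;> simp

theorem extend_add (x y : Cone A) (t : ℝ) : (x + y).extend t = x.extend t + y.extend t := by
  simp only [extend]
  split_ifs <;> simp

theorem extend_sub (x y : Cone A) (t : ℝ) : (x - y).extend t = x.extend t - y.extend t := by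
  simp only [extend]
  split_ifs <;> simp

theorem extend_mul (x y : Cone A) (t : ℝ) : (x * y).extend t = x.extend t * y.extend t := by
  simp only [extend]
  split_ifs <;> simp

theorem extend_star (x : Cone A) (t : ℝ) : (star x).extend t = star (x.extend t) := by
  simp only [extend]
  split_ifs <;> simp

/-- The endomorphism of the cone which maps `x` to `t ↦ x (ρ t)`. -/
noncomputable def dilate (ρ : ℝ) : Cone A →⋆ₙₐ[ℂ] Cone A where
  toFun x :=
    { toFun := fun t => x.extend (ρ * t)
      continuous_toFun := x.continuous_extend.comp (by fun_prop)
      zero_at_infty' := by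
        have h : Tendsto (fun t : ℝ => x.extend (ρ * t)) (𝓝 0) (𝓝 0) := by
          have := (x.continuous_extend.comp (continuous_const_mul ρ)).tendsto 0
          simpa [extend_of_nonpos x le_rfl, Function.comp_def] using this
        exact h.comp tendsto_val_cocompact }
  map_smul' c x := ZeroAtInftyContinuousMap.ext fun _ => extend_smul c x _
  map_zero' := ZeroAtInftyContinuousMap.ext fun _ => extend_zero _
  map_add' x y := ZeroAtInftyContinuousMap.ext fun _ => extend_add x y _
  map_mul' x y := ZeroAtInftyContinuousMap.ext fun _ => extend_mul x y _
  map_star' x := ZeroAtInftyContinuousMap.ext fun _ => extend_star x _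

theorem dilate_apply (ρ : ℝ) (x : Cone A) (t : Set.Ioc (0 : ℝ) 1) :
    dilate ρ x t = x.extend (ρ * t) := rfl

theorem dilate_one (x : Cone A) : dilate 1 x = x := by
  ext t
  rw [dilate_apply, one_mul, extend_coe]

theorem dilate_zero (x : Cone A) : dilate 0 x = 0 := by
  ext t
  rw [dilate_apply, zero_mul, extend_of_nonpos x le_rfl]
  rfl

theorem norm_dilate_le (ρ : ℝ) (x : Cone A) : ‖dilate ρ x‖ ≤ ‖x‖ :=
  norm_le (norm_nonneg x) fun _ => norm_extend_le x _

theorem continuous_dilate (x : Cone A) : Continuous fun ρ : ℝ => dilate ρ x := by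
  -- Adding the endpoint 0 makes the parameter space compact, so currying gives continuity in the
  -- sup norm.
  let G : C(ℝ × Set.Icc (0 : ℝ) 1, A) :=
    ⟨fun p => x.extend (p.1 * p.2), x.continuous_extend.comp (by fun_prop)⟩
  refine Metric.continuous_iff.2 fun ρ ε hε => ?_
  obtain ⟨δ, hδ, h⟩ := Metric.continuous_iff.1 G.curry.continuous ρ ε hε
  refine ⟨δ, hδ, fun ρ' hρ' => lt_of_le_of_lt ?_ (h ρ' hρ')⟩
  rw [dist_eq_norm]
  refine norm_le dist_nonneg fun t => ?_
  have := ContinuousMap.dist_apply_le_dist (f := G.curry ρ') (g := G.curry ρ)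
    ⟨(t : ℝ), t.2.1.le, t.2.2⟩
  rwa [dist_eq_norm] at this

theorem exists_norm_dilate_sub_lt (x : Cone A) {η : ℝ} (hη : 0 < η) :
    ∃ δ > 0, ∀ ρ ∈ Set.Icc (0 : ℝ) 1, ∀ ρ' ∈ Set.Icc (0 : ℝ) 1, |ρ - ρ'| < δ →
      ‖dilate ρ x - dilate ρ' x‖ < η := by
  have h := isCompact_Icc.uniformContinuousOn_of_continuous
    (continuous_dilate x).continuousOn (s := Set.Icc (0 : ℝ) 1)
  obtain ⟨δ, hδ, h⟩ := Metric.uniformContinuousOn_iff.1 h η hη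
  refine ⟨δ, hδ, fun ρ hρ ρ' hρ' hd => ?_⟩
  have := h ρ hρ ρ' hρ' (by rwa [Real.dist_eq])
  rwa [dist_eq_norm] at this

/-- The cone embeds isometrically in `C([0, 1], A)`. This supplies the dense sequence on which
multiplicativity is tested. -/
instance [TopologicalSpace.SeparableSpace A] : SecondCountableTopology (Cone A) := by
  have := UniformSpace.secondCountable_of_separable A
  let Φ : Cone A → C(Set.Icc (0 : ℝ) 1, A) := fun x =>
    ⟨fun t => x.extend t, x.continuous_extend.comp continuous_subtype_val⟩
  have hΦ : Isometry Φ := by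
    refine Isometry.of_dist_eq fun x y => le_antisymm ?_ ?_
    · refine (ContinuousMap.dist_le dist_nonneg).2 fun t => ?_
      rw [dist_eq_norm, dist_eq_norm]
      change ‖x.extend t - y.extend t‖ ≤ _
      rw [← extend_sub]
      exact norm_extend_le _ _
    · rw [dist_eq_norm]
      refine norm_le dist_nonneg fun t => ?_
      have := ContinuousMap.dist_apply_le_dist (f := Φ x) (g := Φ y)
        ⟨(t : ℝ), t.2.1.le, t.2.2⟩
      rw [dist_eq_norm] at this
      change ‖x.extend t - y.extend t‖ ≤ _ at this
      rwa [← extend_sub, extend_coe] at this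
  exact hΦ.isUniformInducing.isInducing.secondCountableTopology

end Cone

/-! ### Completely positive compressions. -/

section Compression

variable {B : Type*} [NonUnitalCStarAlgebra B]

open Unitization in
theorem Unitization.inr_snd_star_mul_inr_mul (S T : Unitization ℂ B) (b : B) :
    (inr (S * inr b * T).snd : Unitization ℂ B) = S * inr b * T := by
  refine Unitization.ext ?_ (by simp)
  simp

variable [PartialOrder B] [StarOrderedRing B]

theorem CStarAlgebra.exists_eq_star_mul_self {b : B} (hb : 0 ≤ b) : ∃ c, b = star c * c :=
  CStarAlgebra.nonneg_iff_eq_star_mul_self.1 hb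

open Unitization in
theorem CStarMatrix.map_compress_nonneg (T : Unitization ℂ B) {k : ℕ}
    {M : CStarMatrix (Fin k) (Fin k) B} (hM : 0 ≤ M) :
    0 ≤ M.map fun b => (star T * inr b * T).snd := by
  obtain ⟨N, rfl⟩ := CStarAlgebra.exists_eq_star_mul_self hM
  -- With `M = star N * N`, the compressed matrix is `star (N T) * (N T)`, and `N T` has entries in
  -- `B` since `B` is an ideal of its unitization. The factor 1 only matches the form of
  -- `inr_snd_star_mul_inr_mul`.
  refine le_of_le_of_eq (star_mul_self_nonneg (N.map fun b => (1 * inr b * T).snd)) (Eq.symm ?_)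
  ext i j
  apply Unitization.inr_injective (R := ℂ)
  have hsum : ∀ g : Fin k → B, (inr (∑ l, g l) : Unitization ℂ B) = ∑ l, inr (g l) :=
    fun g => map_sum (inrNonUnitalAlgHom ℂ B) g _
  rw [CStarMatrix.map_apply, inr_snd_star_mul_inr_mul, CStarMatrix.mul_apply,
    CStarMatrix.mul_apply, hsum, hsum, Finset.mul_sum, Finset.sum_mul]
  refine Finset.sum_congr rfl fun l _ => ?_
  rw [inr_mul, inr_mul, CStarMatrix.star_apply, CStarMatrix.star_apply, CStarMatrix.map_apply,
    CStarMatrix.map_apply, inr_star, inr_star, inr_snd_star_mul_inr_mul,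
    inr_snd_star_mul_inr_mul]
  simp only [star_mul, mul_assoc, one_mul]

variable {E : Type*} [NonUnitalCStarAlgebra E] [PartialOrder E] [StarOrderedRing E]

open Unitization in
/-- The completely positive map `x ↦ ∑ k < N, star (T k) * φ (σ k x) * T k`, where the `T k` are
elements of the unitization of `B`. -/
noncomputable def CompletelyPositiveMap.sumCompress (φ : E →CP B) (σ : ℕ → E →⋆ₙₐ[ℂ] E)
    (T : ℕ → Unitization ℂ B) (N : ℕ) : E →CP B where
  toFun x := ∑ k ∈ Finset.range N, (star (T k) * inr (φ (σ k x)) * T k).snd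
  map_add' x y := by
    simp only [map_add, inr_add, mul_add, add_mul, snd_add, Finset.sum_add_distrib]
  map_smul' c x := by
    simp only [map_smul, inr_smul, mul_smul_comm, smul_mul_assoc, snd_smul, Finset.smul_sum,
      RingHom.id_apply]
  map_cstarMatrix_nonneg' n M hM := by
    have h : ∀ k, 0 ≤ (M.map (σ k)).map φ := fun k => φ.map_cstarMatrix_nonneg' n _
      (CompletelyPositiveMapClass.map_cstarMatrix_nonneg' (σ k) n M hM)
    change 0 ≤ M.map fun x => ∑ k ∈ Finset.range N, (star (T k) * inr (φ (σ k x)) * T k).snd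
    induction N with
    | zero => exact le_of_eq (by ext i j; simp [CStarMatrix.map_apply])
    | succ N ih =>
      refine le_of_le_of_eq (add_nonneg ih (CStarMatrix.map_compress_nonneg (T N) (h N))) ?_
      ext i j
      exact (Finset.sum_range_succ _ N).symm

open Unitization in
theorem CompletelyPositiveMap.inr_sumCompress (φ : E →CP B) (σ : ℕ → E →⋆ₙₐ[ℂ] E)
    (T : ℕ → Unitization ℂ B) (N : ℕ) (x : E) :
    (inr (φ.sumCompress σ T N x) : Unitization ℂ B)
      = ∑ k ∈ Finset.range N, star (T k) * inr (φ (σ k x)) * T k := by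
  change inr (∑ k ∈ Finset.range N, (star (T k) * inr (φ (σ k x)) * T k).snd) = _
  exact (map_sum (inrNonUnitalAlgHom ℂ B) _ _).trans
    (Finset.sum_congr rfl fun k _ => inr_snd_star_mul_inr_mul _ _ _)

end Compression

/-! ### The tent partition of unity. -/

section Tent

/-- The square roots of the members of a partition of unity on `[0, ∞)` into tent functions. -/
noncomputable def sqrtTent (k : ℕ) (s : ℝ) : ℝ := √(max 0 (1 - |s - k|))

theorem continuous_sqrtTent (k : ℕ) : Continuous (sqrtTent k) := by
  unfold sqrtTent
  fun_prop

theorem sqrtTent_eq_zero {k : ℕ} {s : ℝ} (h : 1 ≤ |s - k|) : sqrtTent k s = 0 := by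
  rw [sqrtTent, max_eq_left (by linarith), Real.sqrt_zero]

theorem sqrtTent_zero_zero : sqrtTent 0 0 = 1 := by simp [sqrtTent]

theorem sqrtTent_apply_zero {k : ℕ} (hk : k ≠ 0) : sqrtTent k 0 = 0 := by
  refine sqrtTent_eq_zero ?_
  have : (1 : ℝ) ≤ k := by exact_mod_cast Nat.one_le_iff_ne_zero.2 hk
  rw [zero_sub, abs_neg]
  exact this.trans (le_abs_self _)

theorem sqrtTent_mul_eq_zero {j k : ℕ} (h : j + 1 < k ∨ k + 1 < j) (s : ℝ) :
    sqrtTent j s * sqrtTent k s = 0 := by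
  by_cases hj : 1 ≤ |s - j|
  · rw [sqrtTent_eq_zero hj, zero_mul]
  · rw [sqrtTent_eq_zero (k := k), mul_zero]
    rw [not_le, abs_lt] at hj
    rw [le_abs]
    rcases h with h | h
    · have : (j : ℝ) + 2 ≤ k := by exact_mod_cast h
      right; linarith
    · have : (k : ℝ) + 2 ≤ j := by exact_mod_cast h
      left; linarith

theorem sum_sqrtTent_mul_self {N : ℕ} {s : ℝ} (h0 : 0 ≤ s) (hN : s + 1 ≤ N) :
    ∑ k ∈ Finset.range N, sqrtTent k s * sqrtTent k s = 1 := by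
  -- Partial sums of tents are trapezoids, written as a difference of two clipped ramps.
  have h : ∀ N : ℕ, ∑ k ∈ Finset.range N, sqrtTent k s * sqrtTent k s
      = min 1 (max 0 (s + 1)) - min 1 (max 0 (s + 1 - N)) := by
    intro N
    induction N with
    | zero => simp
    | succ N ih =>
      rw [Finset.sum_range_succ, ih, sqrtTent, Real.mul_self_sqrt (le_max_left _ _)]
      push_cast
      grind
  rw [h, max_eq_left (show s + 1 - N ≤ 0 by linarith), max_eq_right (by linarith : 0 ≤ s + 1),
    min_eq_left (by linarith)]
  simp

end Tent

/-! ### Continuous quasicentral paths. -/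

section Path

variable {B : Type*} [NonUnitalCStarAlgebra B] [PartialOrder B] [StarOrderedRing B]

/-- A norm-continuous quasicentral approximate unit of a closed ideal, with prescribed quality with
respect to sequences of compact sets. -/
theorem TwoSidedIdeal.exists_quasicentral_path (I : TwoSidedIdeal B)
    (hI : IsClosed (I : Set B)) (F L : ℕ → Set B) (hF : ∀ m, IsCompact (F m))
    (hL : ∀ m, IsCompact (L m)) (hLI : ∀ m, L m ⊆ I) (δ : ℕ → ℝ) (hδ : ∀ m, 0 < δ m) :
    ∃ e : C(Set.Ici (1 : ℝ), B), ∀ t, e t ∈ I ∧ 0 ≤ e t ∧ ‖e t‖ ≤ 1 ∧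
      ∀ m : ℕ, (m : ℝ) ≤ t → (∀ b ∈ F m, ‖e t * b - b * e t‖ ≤ δ m) ∧
        ∀ l ∈ L m, ‖e t * l - l‖ ≤ δ m := by
  -- The conditions on `e` are convex, so locally constant choices can be glued by a partition of
  -- unity.
  refine exists_continuous_forall_mem_convex_of_local_const
    (t := fun t : Set.Ici (1 : ℝ) => {e : B | e ∈ I ∧ 0 ≤ e ∧ ‖e‖ ≤ 1 ∧
      ∀ m : ℕ, (m : ℝ) ≤ t → (∀ b ∈ F m, ‖e * b - b * e‖ ≤ δ m) ∧
        ∀ l ∈ L m, ‖e * l - l‖ ≤ δ m}) (fun t => ?_) fun t => ?_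
  · rintro e ⟨he, he0, he1, heq⟩ e' ⟨he', he0', he1', heq'⟩ a a' ha ha' haa
    have hconv : ∀ {x y : B} {c : ℝ}, ‖x‖ ≤ c → ‖y‖ ≤ c → ‖a • x + a' • y‖ ≤ c := by
      intro x y c hx hy
      calc _ ≤ a * ‖x‖ + a' * ‖y‖ := (norm_add_le _ _).trans_eq (by
            rw [norm_smul, norm_smul, Real.norm_of_nonneg ha, Real.norm_of_nonneg ha'])
        _ ≤ a * c + a' * c := by gcongr
        _ = c := by rw [← add_mul, haa, one_mul]
    refine ⟨?_, add_nonneg (smul_nonneg ha he0) (smul_nonneg ha' he0'), hconv he1 he1',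
      fun m hm => ⟨fun b hb => ?_, fun l hl => ?_⟩⟩
    · have h1 := I.smul_mem_of_isClosed hI (a : ℂ) he
      have h2 := I.smul_mem_of_isClosed hI (a' : ℂ) he'
      rw [Complex.coe_smul] at h1 h2
      exact I.add_mem h1 h2
    · have h : (a • e + a' • e') * b - b * (a • e + a' • e')
          = a • (e * b - b * e) + a' • (e' * b - b * e') := by
        simp only [add_mul, mul_add, smul_mul_assoc, mul_smul_comm, smul_sub]
        abel
      rw [h]
      exact hconv ((heq m hm).1 b hb) ((heq' m hm).1 b hb)
    · have h : (a • e + a' • e') * l - l = a • (e * l - l) + a' • (e' * l - l) := by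
        rw [add_mul, smul_mul_assoc, smul_mul_assoc, smul_sub, smul_sub, sub_add_sub_comm,
          ← add_smul, haa, one_smul]
      rw [h]
      exact hconv ((heq m hm).2 l hl) ((heq' m hm).2 l hl)
  -- Near `t` only the finitely many indices below `M` impose conditions; the smallest of their
  -- tolerances serves all of them.
  · obtain ⟨M, hM⟩ := exists_nat_gt (t : ℝ)
    obtain ⟨m₀, -, hm₀⟩ := (Finset.range (M + 1)).exists_min_image δ ⟨0, by simp⟩
    obtain ⟨e, he, he0, he1, heF, heL⟩ := I.exists_quasicentral hI
      (F := ⋃ m ∈ Finset.range (M + 1), F m) (L := ⋃ m ∈ Finset.range (M + 1), L m)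
      ((Finset.range (M + 1)).isCompact_biUnion fun m _ => hF m)
      ((Finset.range (M + 1)).isCompact_biUnion fun m _ => hL m)
      (Set.iUnion₂_subset fun m _ => hLI m) (hδ m₀)
    refine ⟨e, ?_⟩
    filter_upwards [continuous_subtype_val.continuousAt.eventually (eventually_lt_nhds hM)]
      with s hs
    refine ⟨he, he0, he1, fun m hm => ?_⟩
    have hmM : m ∈ Finset.range (M + 1) := by
      have : (m : ℝ) < M := hm.trans_lt hs
      have : m < M := by exact_mod_cast this
      exact Finset.mem_range.2 (by omega)
    exact ⟨fun b hb => (heF b (Set.mem_iUnion₂.2 ⟨m, hmM, hb⟩)).trans (hm₀ m hmM),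
      fun l hl => (heL l (Set.mem_iUnion₂.2 ⟨m, hmM, hl⟩)).trans (hm₀ m hmM)⟩

end Path

/-! ### Functional calculus inside an ideal, and tents of an element. -/

section FunctionalCalculusIdeal

variable {B : Type*} [NonUnitalCStarAlgebra B]

theorem TwoSidedIdeal.cfcₙ_mem (I : TwoSidedIdeal B) (hI : IsClosed (I : Set B)) (g : ℝ → ℝ)
    {h : B} (hh : h ∈ I) : cfcₙ g h ∈ I := by
  have hJ : IsClosed (I.starPart hI : Set B) := hI.inter (hI.preimage continuous_star)
  have : cfcₙ g h ∈ I.starPart hI := _root_.cfcₙ_mem (𝕜' := ℂ) g ⟨hh, I.star_mem_of_isClosed hI hh⟩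
  exact this.1

end FunctionalCalculusIdeal

section TentCalculus

variable {C : Type*} [CStarAlgebra C]

/-- The partition of unity `sqrtTent`, applied to an element. -/
noncomputable def cfcTent (h : C) (k : ℕ) : C := cfc (sqrtTent k) h

theorem star_cfcTent (h : C) (k : ℕ) : star (cfcTent h k) = cfcTent h k :=
  (cfc_predicate (sqrtTent k) h : IsSelfAdjoint _).star_eq

theorem cfcTent_comm (h : C) (j k : ℕ) : cfcTent h j * cfcTent h k = cfcTent h k * cfcTent h j :=
  cfc_commute_cfc _ _ _

theorem cfcTent_mul_cfcTent (h : C) (j k : ℕ) :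
    cfcTent h j * cfcTent h k = cfc (fun s => sqrtTent j s * sqrtTent k s) h :=
  (cfc_mul _ _ h (continuous_sqrtTent j).continuousOn (continuous_sqrtTent k).continuousOn).symm

theorem cfcTent_mul_eq_zero (h : C) {j k : ℕ} (hjk : j + 1 < k ∨ k + 1 < j) :
    cfcTent h j * cfcTent h k = 0 := by
  rw [cfcTent_mul_cfcTent, show (fun s => sqrtTent j s * sqrtTent k s) = fun _ => 0 from
    funext (sqrtTent_mul_eq_zero hjk), cfc_const_zero]

theorem sum_cfcTent_mul_self {h : C} (hsa : IsSelfAdjoint h) {R : ℝ}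
    (hs : spectrum ℝ h ⊆ Set.Icc 0 R) {N : ℕ} (hN : R + 1 ≤ N) :
    ∑ k ∈ Finset.range N, cfcTent h k * cfcTent h k = 1 := by
  simp only [cfcTent_mul_cfcTent]
  rw [← cfc_sum (fun k s => sqrtTent k s * sqrtTent k s) h _ fun k _ =>
    ((continuous_sqrtTent k).mul (continuous_sqrtTent k)).continuousOn, ← cfc_one ℝ h]
  refine cfc_congr fun s hs' => ?_
  simp only [Finset.sum_apply, Pi.one_apply]
  exact sum_sqrtTent_mul_self (hs hs').1 (by linarith [(hs hs').2])

theorem cfcTent_eq_zero {h : C} {R : ℝ} (hs : spectrum ℝ h ⊆ Set.Icc 0 R) {k : ℕ}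
    (hk : R + 1 ≤ k) : cfcTent h k = 0 := by
  rw [cfcTent, ← cfc_const_zero ℝ h]
  refine cfc_congr fun s hs' => sqrtTent_eq_zero ?_
  rw [abs_sub_comm]
  exact le_trans (by linarith [(hs hs').2]) (le_abs_self _)

theorem exists_norm_cfcTent_mul_sub_le (C : Type*) [CStarAlgebra C] {R : ℝ} (hR : 0 ≤ R) (N : ℕ)
    {ε : ℝ} (hε : 0 < ε) :
    ∃ K, 0 ≤ K ∧ ∀ k < N, ∀ h h' b : C, IsSelfAdjoint h → IsSelfAdjoint h' →
      spectrum ℝ h ⊆ Set.Icc 0 R → spectrum ℝ h' ⊆ Set.Icc 0 R →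
      ‖cfcTent h k * b - b * cfcTent h' k‖ ≤ ε * ‖b‖ + K * ‖h * b - b * h'‖ := by
  have H := fun k => exists_norm_cfc_mul_sub_mul_cfc_le C hR
    (continuous_sqrtTent k).continuousOn hε
  choose K hK0 hK using H
  refine ⟨∑ k ∈ Finset.range N, K k, Finset.sum_nonneg fun k _ => hK0 k,
    fun k hk h h' b h1 h2 h3 h4 => (hK k h h' b h1 h2 h3 h4).trans ?_⟩
  gcongr
  exact Finset.single_le_sum (f := K) (fun k _ => hK0 k) (Finset.mem_range.2 hk)

theorem spectrum_inr_smul_subset {B : Type*} [NonUnitalCStarAlgebra B] [PartialOrder B]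
    [StarOrderedRing B] {e : B} (he : 0 ≤ e) (he1 : ‖e‖ ≤ 1) {r : ℝ} (hr : 0 ≤ r) :
    IsSelfAdjoint (Unitization.inr (r • e) : Unitization ℂ B) ∧
      spectrum ℝ (Unitization.inr (r • e) : Unitization ℂ B) ⊆ Set.Icc 0 r := by
  have h0 : 0 ≤ r • e := smul_nonneg hr he
  refine ⟨(IsSelfAdjoint.of_nonneg h0).inr ℂ, fun s hs => ⟨?_, ?_⟩⟩
  · exact spectrum_nonneg_of_nonneg (Unitization.inr_nonneg_iff.2 h0) hs
  · refine (le_abs_self s).trans ((spectrum.norm_le_norm_of_mem hs).trans ?_)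
    rw [Unitization.norm_inr, norm_smul, Real.norm_of_nonneg hr]
    exact mul_le_of_le_one_right hr he1

end TentCalculus

section TentIdeal

variable {B : Type*} [NonUnitalCStarAlgebra B]

open Unitization

/-- For `k ≠ 0` the tent vanishes at 0, so the non-unital calculus applies and stays in `I`. -/
theorem TwoSidedIdeal.exists_cfcTent_eq_inr (I : TwoSidedIdeal B) (hI : IsClosed (I : Set B))
    {h : B} (hh : h ∈ I) {k : ℕ} (hk : k ≠ 0) :
    ∃ i ∈ I, cfcTent (inr h : Unitization ℂ B) k = inr i :=
  ⟨cfcₙ (sqrtTent k) h, I.cfcₙ_mem hI _ hh,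
    (real_cfcₙ_eq_cfc_inr h (sqrtTent k) (sqrtTent_apply_zero hk)).symm⟩

theorem TwoSidedIdeal.exists_cfcTent_zero_eq (I : TwoSidedIdeal B) (hI : IsClosed (I : Set B))
    {h : B} (hsa : IsSelfAdjoint h) (hh : h ∈ I) :
    ∃ i ∈ I, cfcTent (inr h : Unitization ℂ B) 0 = 1 - inr i := by
  refine ⟨cfcₙ (fun s => 1 - sqrtTent 0 s) h, I.cfcₙ_mem hI _ hh, ?_⟩
  rw [real_cfcₙ_eq_cfc_inr h _ (by simp [sqrtTent_zero_zero]),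
    cfc_sub _ _ _ continuous_const.continuousOn (continuous_sqrtTent 0).continuousOn,
    cfc_const_one ℝ _ (hsa.inr ℂ), sub_sub_cancel]
  rfl

end TentIdeal

/-! ### The lift obtained by sliding down the cone. -/

section ConeLift

variable {A B : Type*} [NonUnitalCStarAlgebra A] [NonUnitalCStarAlgebra B] [PartialOrder B]
  [StarOrderedRing B]

open Unitization

/-- The scale by which the `k`-th block of `coneLift` contracts the cone. -/
noncomputable def coneScale (t : ℝ) (k : ℕ) : ℝ := max 0 (1 - k / t)

theorem coneScale_zero (t : ℝ) : coneScale t 0 = 1 := by simp [coneScale]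

theorem coneScale_mem {t : ℝ} (ht : 1 ≤ t) (k : ℕ) : coneScale t k ∈ Set.Icc (0 : ℝ) 1 :=
  ⟨le_max_left _ _, max_le zero_le_one (by
    have : (0 : ℝ) ≤ k / t := by positivity
    linarith)⟩

theorem coneScale_eq_zero {t : ℝ} (ht : 1 ≤ t) {k : ℕ} (hk : t ≤ k) : coneScale t k = 0 :=
  max_eq_left (by
    have : 1 ≤ k / t := (one_le_div (by linarith)).2 hk
    linarith)

theorem abs_coneScale_sub_le {t : ℝ} (ht : 1 ≤ t) {j k : ℕ} (h1 : j ≤ k + 1) (h2 : k ≤ j + 1) :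
    |coneScale t j - coneScale t k| ≤ 1 / t := by
  have ht0 : 0 < t := by linarith
  have h1' : (j : ℝ) ≤ k + 1 := by exact_mod_cast h1
  have h2' : (k : ℝ) ≤ j + 1 := by exact_mod_cast h2
  refine (abs_max_sub_max_le_max _ _ _ _).trans (max_le (by simpa using ht0.le) ?_)
  have : (1 - j / t) - (1 - k / t) = (k - j) / t := by ring
  rw [this, abs_div, abs_of_pos ht0]
  gcongr
  rw [abs_le]
  constructor <;> linarith

/-- The completely positive map obtained from `φ` by contracting the cone along the spectral
decomposition of `e`. -/
noncomputable def coneLift (φ : Cone A →CP B) (e : B) (t : ℝ) : Cone A →CP B :=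
  φ.sumCompress (fun k => Cone.dilate (coneScale t k))
    (cfcTent (inr ((t + 1) • e) : Unitization ℂ B)) (⌊t⌋₊ + 3)

variable {φ : Cone A →CP B} {e : B} {t : ℝ}

/-- The spectrum lies in `[0, t + 1]`, so blocks with `k ≥ t + 2` vanish. The freedom in `N` removes
the jumps of `⌊t⌋₊` when continuity in `t` is proved. -/
theorem inr_coneLift (he : 0 ≤ e) (he1 : ‖e‖ ≤ 1) (ht : 1 ≤ t) {N : ℕ} (hN : ⌊t⌋₊ + 3 ≤ N)
    (x : Cone A) : (inr (coneLift φ e t x) : Unitization ℂ B) =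
      ∑ k ∈ Finset.range N, cfcTent (inr ((t + 1) • e)) k
        * inr (φ (Cone.dilate (coneScale t k) x)) * cfcTent (inr ((t + 1) • e)) k := by
  rw [coneLift, CompletelyPositiveMap.inr_sumCompress]
  simp only [star_cfcTent]
  refine Finset.sum_subset (Finset.range_subset_range.2 hN) fun k _ hk => ?_
  have hs := (spectrum_inr_smul_subset he he1 (by linarith : 0 ≤ t + 1)).2
  rw [cfcTent_eq_zero hs, mul_zero]
  have h1 : ⌊t⌋₊ + 3 ≤ k := by simpa using hk
  have h2 := (Nat.lt_floor_add_one t).le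
  have h3 : (⌊t⌋₊ : ℝ) + 3 ≤ k := by exact_mod_cast h1
  linarith

theorem sum_cfcTent_eq_one (he : 0 ≤ e) (he1 : ‖e‖ ≤ 1) (ht : 1 ≤ t) :
    ∑ k ∈ Finset.range (⌊t⌋₊ + 3), cfcTent (inr ((t + 1) • e) : Unitization ℂ B) k
      * cfcTent (inr ((t + 1) • e)) k = 1 := by
  obtain ⟨hsa, hs⟩ := spectrum_inr_smul_subset he he1 (by linarith : 0 ≤ t + 1)
  refine sum_cfcTent_mul_self hsa hs ?_
  have := (Nat.lt_floor_add_one t).le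
  push_cast
  linarith

theorem coneLift_contractive (hφ : IsContractive φ) (he : 0 ≤ e) (he1 : ‖e‖ ≤ 1) (ht : 1 ≤ t) :
    IsContractive (coneLift φ e t) := by
  intro x
  rw [← norm_inr (𝕜 := ℂ), inr_coneLift he he1 ht le_rfl]
  refine norm_sum_conj_le (star_cfcTent _) (sum_cfcTent_eq_one he he1 ht) _ (norm_nonneg x)
    fun k _ => ?_
  rw [norm_inr]
  exact (hφ _).trans (Cone.norm_dilate_le _ x)

/-- Blocks with `k ≠ 0` lie in `I`; the block `k = 0` has scale 1 and `T 0 ∈ 1 + I`, so it agrees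
with `φ x` modulo `I`. -/
theorem coneLift_isLift {I : TwoSidedIdeal B} {hI : IsClosed (I : Set B)}
    {f : Cone A →⋆ₙₐ[ℂ] CStarQuotient I hI} (hφ : IsLift φ f) (heI : e ∈ I) (he : 0 ≤ e) :
    IsLift (coneLift φ e t) f := by
  intro x
  rw [← hφ x]
  refine CStarQuotient.of_eq_of_iff.2 ?_
  have hh : (t + 1) • e ∈ I := by
    have := I.smul_mem_of_isClosed hI ((t + 1 : ℝ) : ℂ) heI
    rwa [Complex.coe_smul] at this
  have hsa : IsSelfAdjoint ((t + 1) • e) := (IsSelfAdjoint.all _).smul (.of_nonneg he)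
  have hsum : coneLift φ e t x = ∑ k ∈ Finset.range (⌊t⌋₊ + 3),
      (star (cfcTent (inr ((t + 1) • e) : Unitization ℂ B) k)
        * inr (φ (Cone.dilate (coneScale t k) x)) * cfcTent (inr ((t + 1) • e)) k).snd := rfl
  simp only [star_cfcTent] at hsum
  rw [hsum, Finset.sum_range_succ', add_sub_assoc]
  refine I.add_mem (I.finsetSum_mem _ _ fun k _ => ?_) ?_
  · obtain ⟨i, hi, h⟩ := I.exists_cfcTent_eq_inr hI hh (Nat.succ_ne_zero k)
    rw [h, ← inr_mul, ← inr_mul, snd_inr]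
    exact I.mul_mem_left _ _ hi
  · obtain ⟨i, hi, h⟩ := I.exists_cfcTent_zero_eq hI hsa hh
    rw [h, coneScale_zero, Cone.dilate_one]
    have : ((1 - inr i) * inr (φ x) * (1 - inr i) : Unitization ℂ B)
        = inr (φ x) + inr (-(i * φ x) - φ x * i + i * φ x * i) := by
      simp only [inr_add, inr_sub, inr_neg, inr_mul]
      noncomm_ring
    rw [this, ← inr_add, snd_inr, add_sub_cancel_left]
    exact I.add_mem (I.sub_mem (I.neg_mem (I.mul_mem_right _ _ hi)) (I.mul_mem_left _ _ hi))
      (I.mul_mem_left _ _ hi)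

theorem IsContractive.continuous (hφ : IsContractive φ) : Continuous φ :=
  AddMonoidHomClass.continuous_of_bound φ 1 fun x => by simpa using hφ x

theorem continuous_coneLift (hφ : IsContractive φ) (e : C(Set.Ici (1 : ℝ), B))
    (he : ∀ t, 0 ≤ e t) (he1 : ∀ t, ‖e t‖ ≤ 1) (x : Cone A) :
    Continuous fun t : Set.Ici (1 : ℝ) => coneLift φ (e t) t x := by
  rw [(isometry_inr (𝕜 := ℂ) (A := B)).isEmbedding.continuous_iff]
  have hcalc : ∀ k, Continuous fun t : Set.Ici (1 : ℝ) =>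
      cfcTent (inr (((t : ℝ) + 1) • e t) : Unitization ℂ B) k := by
    intro k
    refine Continuous.cfc (s := fun t : Set.Ici (1 : ℝ) => Set.Icc (0 : ℝ) (t + 2)) _ ?_
      (fun _ => isCompact_Icc) (fun t₀ => ?_) (fun _ => (continuous_sqrtTent k).continuousOn)
      fun t => (spectrum_inr_smul_subset (he t) (he1 t) (by linarith [t.2.out])).1
    · exact (isometry_inr (𝕜 := ℂ) (A := B)).continuous.comp
        ((continuous_subtype_val.add continuous_const).smul e.continuous)
    · filter_upwards [continuous_subtype_val.continuousAt.eventually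
        (eventually_lt_nhds (show (t₀ : ℝ) < t₀ + 1 by linarith))] with t ht
      exact (spectrum_inr_smul_subset (he t) (he1 t) (by linarith [t.2.out])).2.trans
        (Set.Icc_subset_Icc_right (by linarith))
  refine continuous_iff_continuousAt.2 fun t₀ => ?_
  obtain ⟨M, hM⟩ := exists_nat_gt (t₀ : ℝ)
  have hev : ∀ᶠ t : Set.Ici (1 : ℝ) in 𝓝 t₀,
      ∑ k ∈ Finset.range (M + 3), cfcTent (inr (((t : ℝ) + 1) • e t)) k
        * inr (φ (Cone.dilate (coneScale t k) x)) * cfcTent (inr (((t : ℝ) + 1) • e t)) k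
        = (inr (coneLift φ (e t) t x) : Unitization ℂ B) := by
    filter_upwards [continuous_subtype_val.continuousAt.eventually (eventually_lt_nhds hM)]
      with t ht
    refine (inr_coneLift (he t) (he1 t) t.2 ?_ x).symm
    have : ⌊(t : ℝ)⌋₊ ≤ M := Nat.floor_le_of_le ht.le
    omega
  refine ContinuousAt.congr ?_ hev
  refine Continuous.continuousAt (continuous_finsetSum _ fun k _ => ?_)
  refine ((hcalc k).mul ?_).mul (hcalc k)
  refine (isometry_inr (𝕜 := ℂ) (A := B)).continuous.comp (hφ.continuous.comp
    ((Cone.continuous_dilate x).comp ?_))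
  refine continuous_const.max (continuous_const.sub (continuous_const.div continuous_subtype_val
    fun t => ?_))
  have := t.2.out
  positivity

end ConeLift

/-! ### Asymptotic multiplicativity. -/

section Multiplicativity

variable {A B : Type*} [NonUnitalCStarAlgebra A] [NonUnitalCStarAlgebra B] [PartialOrder B]
  [StarOrderedRing B] {φ : Cone A →CP B}

open Unitization

/-- The spectral interval is enlarged to `[0, ⌊t⌋₊ + 2]`, so that `K` can be fixed once for each
integer. The factor `‖x‖ + 2 * (‖x‖ * ‖y‖) + 1` is a common bound for the commutator and the defect
errors. -/
theorem norm_coneLift_mul_sub_le (hφ : IsContractive φ) {e : B} (he : 0 ≤ e) (he1 : ‖e‖ ≤ 1)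
    {t : ℝ} (ht : 1 ≤ t) (x y : Cone A) {ε K δ η : ℝ} (hε : 0 ≤ ε) (hK0 : 0 ≤ K) (hη0 : 0 ≤ η)
    (hK : ∀ k < ⌊t⌋₊ + 3, ∀ h h' b : Unitization ℂ B, IsSelfAdjoint h → IsSelfAdjoint h' →
      spectrum ℝ h ⊆ Set.Icc (0 : ℝ) (⌊t⌋₊ + 2) → spectrum ℝ h' ⊆ Set.Icc (0 : ℝ) (⌊t⌋₊ + 2) →
      ‖cfcTent h k * b - b * cfcTent h' k‖ ≤ ε * ‖b‖ + K * ‖h * b - b * h'‖)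
    (hcomm : ∀ ρ ∈ Set.Icc (0 : ℝ) 1,
      ‖e * φ (Cone.dilate ρ x) - φ (Cone.dilate ρ x) * e‖ ≤ δ)
    (hunit : ∀ ρ ∈ Set.Icc (0 : ℝ) 1,
      ‖e * (φ (Cone.dilate ρ x) * φ (Cone.dilate ρ y) - φ (Cone.dilate ρ (x * y)))
        - (φ (Cone.dilate ρ x) * φ (Cone.dilate ρ y) - φ (Cone.dilate ρ (x * y)))‖ ≤ δ)
    (hη : ∀ ρ ∈ Set.Icc (0 : ℝ) 1, ∀ ρ' ∈ Set.Icc (0 : ℝ) 1, |ρ - ρ'| ≤ 1 / t →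
      ‖Cone.dilate ρ x - Cone.dilate ρ' x‖ ≤ η)
    (hKδ : K * ((⌊t⌋₊ + 2) * δ) ≤ ε) :
    ‖coneLift φ e t (x * y) - coneLift φ e t x * coneLift φ e t y‖
      ≤ (⌊t⌋₊ + 3) * (ε * (‖x‖ + 2 * (‖x‖ * ‖y‖) + 1) * ‖y‖)
        + 3 * ((ε * (‖x‖ + 2 * (‖x‖ * ‖y‖) + 1) + η) * ‖y‖)
        + (⌊t⌋₊ + 3) * (ε * (‖x‖ + 2 * (‖x‖ * ‖y‖) + 1)) := by
  have hlt := Nat.lt_floor_add_one t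
  have hR : t + 1 ≤ ⌊t⌋₊ + 2 := by linarith
  obtain ⟨hsa, hs⟩ := spectrum_inr_smul_subset he he1 (by linarith : 0 ≤ t + 1)
  have hs' := hs.trans (Set.Icc_subset_Icc_right hR)
  set h : Unitization ℂ B := inr ((t + 1) • e) with hh
  have hx : ∀ ρ, ‖φ (Cone.dilate ρ x)‖ ≤ ‖x‖ := fun ρ => (hφ _).trans (Cone.norm_dilate_le ρ x)
  have hy : ∀ ρ, ‖φ (Cone.dilate ρ y)‖ ≤ ‖y‖ := fun ρ => (hφ _).trans (Cone.norm_dilate_le ρ y)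
  have hxy : ∀ ρ, ‖φ (Cone.dilate ρ (x * y))‖ ≤ ‖x‖ * ‖y‖ := fun ρ =>
    ((hφ _).trans (Cone.norm_dilate_le ρ _)).trans (norm_mul_le x y)
  have hscale : ∀ {z : B}, ‖z‖ ≤ δ → K * ‖(t + 1) • z‖ ≤ ε := by
    intro z hz
    refine le_trans ?_ hKδ
    rw [norm_smul, Real.norm_of_nonneg (by linarith : 0 ≤ t + 1)]
    gcongr
  rw [norm_sub_rev, ← norm_inr (𝕜 := ℂ), inr_sub, inr_mul]
  have key := norm_sum_conj_mul_sub_le (star_cfcTent h) (cfcTent_comm h)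
    (fun j k => cfcTent_mul_eq_zero h) (sum_cfcTent_eq_one he he1 ht)
    (fun k => inr (φ (Cone.dilate (coneScale t k) x)))
    (fun k => inr (φ (Cone.dilate (coneScale t k) y)))
    (fun k => inr (φ (Cone.dilate (coneScale t k) (x * y)))) (M := ‖y‖)
    (δ := ε * (‖x‖ + 2 * (‖x‖ * ‖y‖) + 1)) (η := η) (norm_nonneg y) (by positivity) hη0
    (fun k _ => by rw [norm_inr]; exact hy _) (fun j _ k hk => ?_) (fun k hk => ?_)
    (fun j _ k _ h1 h2 => ?_)
  · rw [← inr_coneLift he he1 ht le_rfl, ← inr_coneLift he he1 ht le_rfl,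
      ← inr_coneLift he he1 ht le_rfl] at key
    exact_mod_cast key
  · refine (hK k hk h h _ hsa hsa hs' hs').trans ?_
    have e1 : h * inr (φ (Cone.dilate (coneScale t j) x))
        - inr (φ (Cone.dilate (coneScale t j) x)) * h
        = inr ((t + 1) • (e * φ (Cone.dilate (coneScale t j) x)
          - φ (Cone.dilate (coneScale t j) x) * e)) := by
      rw [hh, ← inr_mul, ← inr_mul, ← inr_sub, smul_mul_assoc, mul_smul_comm, smul_sub]
    rw [e1, norm_inr, norm_inr]
    calc _ ≤ ε * ‖x‖ + ε := add_le_add (by gcongr; exact hx _)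
          (hscale (hcomm _ (coneScale_mem ht j)))
      _ = ε * (‖x‖ + 0 + 1) := by ring
      _ ≤ _ := by gcongr; positivity
  · rcases le_or_gt t k with hkt | hkt
    · rw [coneScale_eq_zero ht hkt, Cone.dilate_zero, Cone.dilate_zero, Cone.dilate_zero, map_zero,
        inr_zero, mul_zero, sub_zero, mul_zero, norm_zero]
      positivity
    · set l := φ (Cone.dilate (coneScale t k) x) * φ (Cone.dilate (coneScale t k) y)
        - φ (Cone.dilate (coneScale t k) (x * y)) with hl
      have hln : ‖l‖ ≤ 2 * (‖x‖ * ‖y‖) := by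
        have h1 : ‖φ (Cone.dilate (coneScale t k) x) * φ (Cone.dilate (coneScale t k) y)‖
            ≤ ‖x‖ * ‖y‖ := (norm_mul_le _ _).trans (by gcongr; exacts [hx _, hy _])
        linarith [norm_sub_le (φ (Cone.dilate (coneScale t k) x)
          * φ (Cone.dilate (coneScale t k) y)) (φ (Cone.dilate (coneScale t k) (x * y))),
          hxy (coneScale t k)]
      -- Here `k < t`, so `t + 1` is outside the `k`-th tent. Intertwining `h` with the scalar `t +
      -- 1` through `l` then shows that `T k * l` is small.
      have hzero : cfcTent (algebraMap ℝ (Unitization ℂ B) (t + 1)) k = 0 := by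
        rw [cfcTent, cfc_algebraMap, sqrtTent_eq_zero, map_zero]
        exact le_trans (by linarith) (le_abs_self _)
      have hspec : spectrum ℝ (algebraMap ℝ (Unitization ℂ B) (t + 1))
          ⊆ Set.Icc (0 : ℝ) (⌊t⌋₊ + 2) :=
        (CFC.spectrum_algebraMap_subset (t + 1)).trans
          (Set.singleton_subset_iff.2 ⟨by linarith, hR⟩)
      have h1 := hK k hk h (algebraMap ℝ _ (t + 1)) (inr l) hsa (.algebraMap _ (.all _)) hs' hspec
      have e1 : h * inr l - inr l * algebraMap ℝ (Unitization ℂ B) (t + 1)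
          = inr ((t + 1) • (e * l - l)) := by
        rw [hh, ← Algebra.commutes, ← Algebra.smul_def, ← inr_mul, ← inr_smul, ← inr_sub,
          smul_mul_assoc, ← smul_sub]
      rw [hzero, mul_zero, sub_zero, e1, norm_inr, norm_inr] at h1
      rw [← inr_mul, ← inr_sub]
      refine h1.trans ?_
      calc _ ≤ ε * (2 * (‖x‖ * ‖y‖)) + ε := add_le_add (by gcongr)
            (hscale (hunit _ (coneScale_mem ht k)))
        _ = ε * (0 + 2 * (‖x‖ * ‖y‖) + 1) := by ring
        _ ≤ _ := by gcongr; positivity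
  · rw [← inr_sub, norm_inr, ← map_sub]
    exact (hφ _).trans (hη _ (coneScale_mem ht j) _ (coneScale_mem ht k)
      (abs_coneScale_sub_le ht h1 h2))

/-- The defect is biadditive and bounded by `2 * (‖a‖ * ‖b‖)` uniformly in `l`. -/
theorem tendsto_norm_map_mul_sub_of_dense {Λ E F : Type*} [Preorder Λ] [NonUnitalCStarAlgebra E]
    [NonUnitalCStarAlgebra F] {G : Type*} [FunLike G E F] [AddMonoidHomClass G E F] {g : Λ → G}
    (hg : ∀ l x, ‖g l x‖ ≤ ‖x‖) {D : Set E} (hD : Dense D)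
    (h : ∀ x ∈ D, ∀ y ∈ D, Tendsto (fun l => ‖g l (x * y) - g l x * g l y‖) atTop (𝓝 0))
    (x y : E) : Tendsto (fun l => ‖g l (x * y) - g l x * g l y‖) atTop (𝓝 0) := by
  have step : ∀ x x' y y' : E, ∀ l, ‖g l (x * y) - g l x * g l y‖
      ≤ ‖g l (x' * y') - g l x' * g l y'‖ + (2 * (‖x - x'‖ * ‖y‖) + 2 * (‖x'‖ * ‖y - y'‖)) := by
    intro x x' y y' l
    have e : g l (x * y) - g l x * g l y = (g l (x' * y') - g l x' * g l y')
        + ((g l ((x - x') * y) - g l (x - x') * g l y)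
          + (g l (x' * (y - y')) - g l x' * g l (y - y'))) := by
      simp only [sub_mul, mul_sub, map_sub]
      abel
    have hb : ∀ a b : E, ‖g l (a * b) - g l a * g l b‖ ≤ 2 * (‖a‖ * ‖b‖) := by
      intro a b
      have h1 := (hg l (a * b)).trans (norm_mul_le a b)
      have h2 : ‖g l a * g l b‖ ≤ ‖a‖ * ‖b‖ := (norm_mul_le _ _).trans
        (mul_le_mul (hg l a) (hg l b) (norm_nonneg _) (norm_nonneg _))
      linarith [norm_sub_le (g l (a * b)) (g l a * g l b)]
    rw [e]
    refine (norm_add_le _ _).trans (add_le_add le_rfl ((norm_add_le _ _).trans ?_))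
    exact add_le_add (hb _ _) (hb _ _)
  have approx : ∀ (z : E) (c : ℝ), 0 ≤ c → ∀ ε > 0, ∃ z' ∈ D, 2 * (c * ‖z - z'‖) < ε := by
    intro z c hc ε hε
    obtain ⟨z', hz', hd⟩ := hD.exists_dist_lt z (show 0 < ε / (2 * (c + 1)) by positivity)
    refine ⟨z', hz', ?_⟩
    rw [dist_eq_norm, lt_div_iff₀ (by positivity)] at hd
    nlinarith [norm_nonneg (z - z')]
  rw [Metric.tendsto_nhds]
  intro ε hε
  obtain ⟨x', hx', hxx⟩ := approx x ‖y‖ (norm_nonneg y) (ε / 3) (by positivity)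
  -- `y'` is chosen after `x'`, because its error is weighted by `‖x'‖`.
  obtain ⟨y', hy', hyy⟩ := approx y ‖x'‖ (norm_nonneg x') (ε / 3) (by positivity)
  filter_upwards [(h x' hx' y' hy').eventually_lt_const (show (0 : ℝ) < ε / 3 by positivity)]
    with l hl
  rw [Real.dist_0_eq_abs, abs_norm]
  have := step x x' y y' l
  rw [mul_comm ‖x - x'‖] at this
  linarith

theorem exists_asymptotically_multiplicative_path [TopologicalSpace.SeparableSpace A]
    (I : TwoSidedIdeal B) (hI : IsClosed (I : Set B)) (hφ : IsContractive φ)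
    (hmul : ∀ x y, φ x * φ y - φ (x * y) ∈ I) :
    ∃ e : C(Set.Ici (1 : ℝ), B), (∀ t, e t ∈ I) ∧ (∀ t, 0 ≤ e t) ∧ (∀ t, ‖e t‖ ≤ 1) ∧
      ∀ x y, Tendsto (fun t : Set.Ici (1 : ℝ) => ‖coneLift φ (e t) t (x * y)
        - coneLift φ (e t) t x * coneLift φ (e t) t y‖) atTop (𝓝 0) := by
  let d : ℕ → Cone A := TopologicalSpace.denseSeq (Cone A)
  -- There are `m + 3` blocks, so the accumulated error is of order `1 / (m + 1)`.
  let ε : ℕ → ℝ := fun m => 1 / ((m + 3) * (m + 1))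
  have hε : ∀ m, 0 < ε m := fun m => by positivity
  choose K hK0 hK using fun m : ℕ => exists_norm_cfcTent_mul_sub_le (Unitization ℂ B)
    (show (0 : ℝ) ≤ m + 2 by positivity) (m + 3) (hε m)
  let δ : ℕ → ℝ := fun m => ε m / ((K m + 1) * (m + 2))
  have hδ : ∀ m, 0 < δ m := fun m => by
    have := hK0 m
    have := hε m
    positivity
  have hKδ : ∀ m, K m * ((m + 2) * δ m) ≤ ε m := by
    intro m
    have h0 := hK0 m
    have e1 : K m * ((m + 2) * δ m) = ε m * (K m / (K m + 1)) := by
      simp only [δ]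
      field_simp
    rw [e1]
    refine mul_le_of_le_one_right (hε m).le ((div_le_one (by positivity)).2 (by linarith))
  have hc : ∀ x, Continuous fun ρ => φ (Cone.dilate ρ x) := fun x =>
    hφ.continuous.comp (Cone.continuous_dilate x)
  obtain ⟨e, he⟩ := I.exists_quasicentral_path hI
    (fun m => ⋃ i ∈ Finset.range (m + 1), (fun ρ => φ (Cone.dilate ρ (d i))) '' Set.Icc 0 1)
    (fun m => ⋃ i ∈ Finset.range (m + 1), ⋃ j ∈ Finset.range (m + 1),
      (fun ρ => φ (Cone.dilate ρ (d i)) * φ (Cone.dilate ρ (d j))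
        - φ (Cone.dilate ρ (d i * d j))) '' Set.Icc 0 1)
    (fun m => Finset.isCompact_biUnion _ fun i _ => isCompact_Icc.image (hc _))
    (fun m => Finset.isCompact_biUnion _ fun i _ => Finset.isCompact_biUnion _ fun j _ =>
      isCompact_Icc.image (((hc _).mul (hc _)).sub (hc _)))
    (fun m => Set.iUnion₂_subset fun i _ => Set.iUnion₂_subset fun j _ => by
      rintro _ ⟨ρ, -, rfl⟩
      simp only [map_mul]
      exact hmul _ _) δ hδ
  refine ⟨e, fun t => (he t).1, fun t => (he t).2.1, fun t => (he t).2.2.1,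
    tendsto_norm_map_mul_sub_of_dense
      (fun t => coneLift_contractive hφ (he t).2.1 (he t).2.2.1 t.2)
      (TopologicalSpace.denseRange_denseSeq (Cone A)) ?_⟩
  rintro _ ⟨i, rfl⟩ _ ⟨j, rfl⟩
  change Tendsto (fun t : Set.Ici (1 : ℝ) => ‖coneLift φ (e t) t (d i * d j)
    - coneLift φ (e t) t (d i) * coneLift φ (e t) t (d j)‖) atTop (𝓝 0)
  set x := d i with hx
  set y := d j with hy
  set S := ‖x‖ + 2 * (‖x‖ * ‖y‖) + 1 with hS
  have hS0 : 0 ≤ S := by positivity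
  rw [Metric.tendsto_nhds]
  intro c hc0
  obtain ⟨r, hr, hη⟩ := Cone.exists_norm_dilate_sub_lt x
    (show 0 < c / (6 * (‖y‖ + 1)) by positivity)
  let t₀ : ℝ := 1 + i + j + 1 / r + 2 * (S * (4 * ‖y‖ + 1)) / c
  have h1 : 0 ≤ 2 * (S * (4 * ‖y‖ + 1)) / c := by positivity
  have h2 : 0 ≤ 1 / r := by positivity
  have h3 : (0 : ℝ) ≤ i := by positivity
  -- In `t₀`, the terms `i` and `j` make both test elements active, `1 / r` forces `1 / t < r`, and
  -- the last term brings the block errors below `c / 2`; the other half of `c` is left for `η`.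
  have h4 : (0 : ℝ) ≤ j := by positivity
  have ht₀ : 1 ≤ t₀ := by
    simp only [t₀]
    linarith
  filter_upwards [eventually_gt_atTop (⟨t₀, ht₀⟩ : Set.Ici (1 : ℝ))] with t ht
  have ht1 : (1 : ℝ) ≤ t := t.2
  have ht' : t₀ < t := ht
  simp only [t₀] at ht'
  set m := ⌊(t : ℝ)⌋₊ with hm
  have hmt : (m : ℝ) ≤ t := Nat.floor_le (by linarith)
  have htm : (t : ℝ) < m + 1 := Nat.lt_floor_add_one _
  have him : i ∈ Finset.range (m + 1) :=
    Finset.mem_range_succ_iff.2 (Nat.le_floor (by linarith))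
  have hjm : j ∈ Finset.range (m + 1) :=
    Finset.mem_range_succ_iff.2 (Nat.le_floor (by linarith))
  have htr : 1 / (t : ℝ) < r := by
    rw [one_div_lt (by linarith) hr]
    linarith
  obtain ⟨heF, heL⟩ := (he t).2.2.2 m hmt
  have key := norm_coneLift_mul_sub_le hφ (he t).2.1 (he t).2.2.1 ht1 x y (hε m).le (hK0 m)
    (show 0 ≤ c / (6 * (‖y‖ + 1)) by positivity) (hK m)
    (fun ρ hρ => heF _ (Set.mem_iUnion₂.2 ⟨i, him, ρ, hρ, rfl⟩))
    (fun ρ hρ => heL _ (Set.mem_iUnion₂.2 ⟨i, him, Set.mem_iUnion₂.2 ⟨j, hjm, ρ, hρ, rfl⟩⟩))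
    (fun ρ hρ ρ' hρ' hd => (hη ρ hρ ρ' hρ' (hd.trans_lt htr)).le) (hKδ m)
  rw [Real.dist_0_eq_abs, abs_norm]
  refine key.trans_lt ?_
  rw [← hm, ← hS]
  have hq : ((m : ℝ) + 3) * ε m = 1 / (m + 1) := by
    simp only [ε]
    field_simp
  have hεq : ε m ≤ 1 / (m + 1) := by
    rw [← hq]
    exact le_mul_of_one_le_left (hε m).le (by linarith)
  have hqt : 1 / ((m : ℝ) + 1) * (S * (4 * ‖y‖ + 1)) < c / 2 := by
    rw [one_div, inv_mul_lt_iff₀ (by linarith)]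
    have : 2 * (S * (4 * ‖y‖ + 1)) / c < m + 1 := by linarith
    rw [div_lt_iff₀ hc0] at this
    linarith
  have hηy : 3 * (c / (6 * (‖y‖ + 1)) * ‖y‖) ≤ c / 2 := by
    have e1 : 3 * (c / (6 * (‖y‖ + 1)) * ‖y‖) = c / 2 * (‖y‖ / (‖y‖ + 1)) := by
      field_simp
      ring
    rw [e1]
    exact mul_le_of_le_one_right (by positivity) ((div_le_one (by positivity)).2 (by linarith))
  calc _ = (((m : ℝ) + 3) * ε m) * (S * (‖y‖ + 1)) + ε m * (3 * (S * ‖y‖))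
        + 3 * (c / (6 * (‖y‖ + 1)) * ‖y‖) := by ring
    _ ≤ 1 / (m + 1) * (S * (‖y‖ + 1)) + 1 / (m + 1) * (3 * (S * ‖y‖)) + c / 2 := by
      rw [hq]
      gcongr
    _ = 1 / ((m : ℝ) + 1) * (S * (4 * ‖y‖ + 1)) + c / 2 := by ring
    _ < c := by linarith

end Multiplicativity

/-! ### Passage to asymptotic homomorphisms and conclusion. -/

theorem isAsymptoticallyStarHom_of_mul {Λ E F : Type*} [Preorder Λ] [NonUnitalCStarAlgebra E]
    [NonUnitalCStarAlgebra F] [PartialOrder E] [StarOrderedRing E] [PartialOrder F]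
    [StarOrderedRing F] {ψ : Λ → E →CP F}
    (h : ∀ x y, Tendsto (fun l => ‖ψ l (x * y) - ψ l x * ψ l y‖) atTop (𝓝 0)) :
    IsAsymptoticallyStarHom fun l x => ψ l x where
  star a := tendsto_const_nhds.congr fun l => by simp [map_star]
  linear a b μ₁ μ₂ := tendsto_const_nhds.congr fun l => by simp
  mul := h

theorem tendsto_natCast_add_one_Ici :
    Tendsto (fun n : ℕ => (⟨n + 1, by simp⟩ : Set.Ici (1 : ℝ))) atTop atTop := by
  refine tendsto_atTop.2 fun t => ?_
  filter_upwards [eventually_ge_atTop ⌈(t : ℝ)⌉₊] with n hn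
  have : (t : ℝ) ≤ n := Nat.ceil_le.1 hn
  exact Subtype.mk_le_mk.2 (show (t : ℝ) ≤ n + 1 by linarith)

theorem theorem4p13 {A B : Type*} [NonUnitalCStarAlgebra A] [TopologicalSpace.SeparableSpace A]
    [NonUnitalCStarAlgebra B] [PartialOrder B] [StarOrderedRing B]
    (I : TwoSidedIdeal B) (hI : IsClosed (I : Set B))
    (f : Cone A →⋆ₙₐ[ℂ] CStarQuotient I hI)
    (hf : ∃ φ : Cone A →CP B, IsContractive φ ∧ IsLift φ f) :
    (∃ ψ : ℕ → (Cone A →CP B),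
      (∀ n, IsContractive (ψ n)) ∧
      (∀ n, IsLift (ψ n) f) ∧
      IsDiscreteAsymptoticHom (fun n x => ψ n x)) ∧
    (∃ ψ : Set.Ici (1 : ℝ) → (Cone A →CP B),
      (∀ t, IsContractive (ψ t)) ∧
      (∀ t, IsLift (ψ t) f) ∧
      IsAsymptoticHom (fun t x => ψ t x)) := by
  obtain ⟨φ, hφ, hlift⟩ := hf
  obtain ⟨e, heI, he, he1, hmul⟩ := exists_asymptotically_multiplicative_path I hI hφ fun x y =>
    CStarQuotient.of_eq_of_iff.1 <| by
      have h : ∀ z, CStarQuotient.of I hI (φ z) = f z := hlift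
      rw [CStarQuotient.of_mul, h, h, h, map_mul]
  have hcontr : ∀ t : Set.Ici (1 : ℝ), IsContractive (coneLift φ (e t) t) := fun t =>
    coneLift_contractive hφ (he t) (he1 t) t.2
  have hl : ∀ t : Set.Ici (1 : ℝ), IsLift (coneLift φ (e t) t) f := fun t =>
    coneLift_isLift hlift (heI t) (he t)
  -- The discrete family samples the continuous one, shifted by 1 to stay in `[1, ∞)`.
  let s : ℕ → Set.Ici (1 : ℝ) := fun n => ⟨n + 1, by simp⟩
  refine ⟨⟨fun n => coneLift φ (e (s n)) (s n), fun n => hcontr _, fun n => hl _,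
    { toIsAsymptoticallyStarHom := isAsymptoticallyStarHom_of_mul fun x y =>
        (hmul x y).comp tendsto_natCast_add_one_Ici
      bounded := fun x => ⟨‖x‖, fun n => hcontr (s n) x⟩ }⟩,
    ⟨fun t => coneLift φ (e t) t, hcontr, hl,
    { toIsAsymptoticallyStarHom := isAsymptoticallyStarHom_of_mul hmul
      continuous := continuous_coneLift hφ e he he1 }⟩⟩
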